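/- Let $T>0$, let $n,m$ be natural numbers, and write $^{\top}$ for the transpose. Assume: (H1) $A\in L^{1}((0,T);\mathbb{R}^{n\times n})$ and $B\in L^{\infty}((0,T);\mathbb{R}^{n\times m})$; (H2) $M\in C^{1}([0,T]^2;\mathbb{R}^{m\times m})$, and $M(t,s)$ is symmetric positive definite for all $t,s\in[0,T]$; (H3) $Q\in C^{1}([0,T]^2;\mathbb{R}^{n\times n})$ and $G\in C^{1}([0,T];\mathbb{R}^{n\times n})$, and $Q(t,s)$, $G(t)$ are symmetric positive semidefinite for all $t,s\in[0,T]$; (H4) $S\in C^{1}([0,T]^2;\mathbb{R}^{m\times n})$; (H5) for all $0\le t\le s\le T$, the matrices $Q_t(t,s)$, $M_t(t,s)$, $\dot G(t)$, $Q(t,s)-S^{\top}(t,s)M^{-1}(t,s)S(t,s)$ and $Q_t(t,s)-S_t^{\top}(t,s)\,(M_t(t,s))^{-1}S_t(t,s)$ are positive semidefinite; here the subscript $t$ denotes the partial derivative in the first variable, and if $M_t(t,s)$ is singular, $(M_t(t,s))^{-1}S_t(t,s)$ stands for any matrix $K$ with $M_t(t,s)K=S_t(t,s)$, which is then required to exist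 (the product $S_t^{\top}K$ does not depend on its choice). For a symmetric $P\in C([0,T];\mathbb{R}^{n\times n})$ put $\Upsilon(s)=M^{-1}(s,s)\big(B^{\top}(s)P(s)+S(s,s)\big)$, and let $\Phi(t,s)$, $t,s\in[0,T]$, be the state-transition matrix of the linear system $\dot X=(A-B\Upsilon)X$, that is, $\Phi(\cdot,s)$ is the continuous function with $$\Phi(t,s)=I+\int_s^t\big(A(\tau)-B(\tau)\Upsilon(\tau)\big)\Phi(\tau,s)\,d\tau .$$ Put $$\bar Q(t,t)=Q(t,t)-\Phi^{\top}(T,t)\dot G(t)\Phi(T,t)-\int_t^T\Phi^{\top}(s,t)Q_t(t,s)\Phi(s,t)\,ds$$ $$\qquad-\int_t^T\Phi^{\top}(s,t)\Big[\Upsilon^{\top}(s)M_t(t,s)\Upsilon(s)-\Upsilon^{\top}(s)S_t(t,s)-S_t^{\top}(t,s)\Upsilon(s)\Big]\Phi(s,t)\,ds .$$ The function $P$ is called a solution of the equilibrium Riccati equation if, for all $t\in[0,T]$, $$P(t)=G(T)+\int_t^T\Big(A^{\top}(s)P(s)+P(s)A(s)+\bar Q(s,s)-\big[P(s)B(s)+S^{\top}(s,s)\big]M^{-1}(s,s)\big[B^{\top}(s)P(s)+S(s,s)\big]\Big)ds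 .$$ Then the equilibrium Riccati equation has exactly one symmetric solution $P\in C([0,T];\mathbb{R}^{n\times n})$. Moreover, $P(t)$ is positive semidefinite for every $t\in[0,T]$. -/

import Mathlib

open MeasureTheory

noncomputable section

namespace EqRiccati

/-- Matrix-valued functions whose entries are in `L¹(0,T)`. -/
def IsL1 (T : ℝ) {p q : ℕ} (F : ℝ → Matrix (Fin p) (Fin q) ℝ) : Prop :=
  ∀ i j, MemLp (fun t => F t i j) 1 (volume.restrict (Set.Icc 0 T))

/-- Matrix-valued functions whose entries are in `L^∞(0,T)`. -/
def IsLinfty (T : ℝ) {p q : ℕ} (F : ℝ → Matrix (Fin p) (Fin q) ℝ) : Prop :=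
  ∀ i j, MemLp (fun t => F t i j) ⊤ (volume.restrict (Set.Icc 0 T))

/-- Matrix-valued functions of class `C¹` on `[0,T]` (one-sided at the end points). -/
def IsC1 (T : ℝ) {p q : ℕ} (F : ℝ → Matrix (Fin p) (Fin q) ℝ) : Prop :=
  ∀ i j, ContDiffOn ℝ 1 (fun t => F t i j) (Set.Icc 0 T)

/-- Matrix-valued functions of class `C¹` on the closed square `[0,T] × [0,T]`. -/
def IsC1Sq (T : ℝ) {p q : ℕ} (F : ℝ → ℝ → Matrix (Fin p) (Fin q) ℝ) : Prop :=
  ∀ i j, ContDiffOn ℝ 1 (fun z : ℝ × ℝ => F z.1 z.2 i j) (Set.Icc 0 T ×ˢ Set.Icc 0 T)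

/-- The entrywise derivative of a matrix-valued function on `[0,T]`. -/
def dot (T : ℝ) {p q : ℕ} (F : ℝ → Matrix (Fin p) (Fin q) ℝ) (t : ℝ) :
    Matrix (Fin p) (Fin q) ℝ :=
  Matrix.of fun i j => derivWithin (fun r => F r i j) (Set.Icc 0 T) t

/-- The entrywise partial derivative `F_t(t,s)` with respect to the first variable. -/
def dfst (T : ℝ) {p q : ℕ} (F : ℝ → ℝ → Matrix (Fin p) (Fin q) ℝ) (t s : ℝ) :
    Matrix (Fin p) (Fin q) ℝ :=
  dot T (fun r => F r s) t

/-- The entrywise integral `∫_a^b F(s) ds`. -/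
def matInt {p q : ℕ} (a b : ℝ) (F : ℝ → Matrix (Fin p) (Fin q) ℝ) :
    Matrix (Fin p) (Fin q) ℝ :=
  Matrix.of fun i j => ∫ s in a..b, F s i j

/-- `Φ` is the state-transition matrix on `[0,T]` of the linear system `X' = a X`:
`∂Φ(t,s)/∂t = a(t) Φ(t,s)`, `Φ(s,s) = I`, in integrated (Carathéodory) form. -/
def IsTransition (T : ℝ) {n : ℕ} (a : ℝ → Matrix (Fin n) (Fin n) ℝ)
    (Φ : ℝ → ℝ → Matrix (Fin n) (Fin n) ℝ) : Prop :=
  ∀ s ∈ Set.Icc 0 T, ContinuousOn (fun t => Φ t s) (Set.Icc 0 T) ∧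
    ∀ t ∈ Set.Icc 0 T, Φ t s = 1 + matInt s t (fun τ => a τ * Φ τ s)

/-- The coefficients of the control problem. -/
structure Coeffs (n m : ℕ) where
  A : ℝ → Matrix (Fin n) (Fin n) ℝ
  B : ℝ → Matrix (Fin n) (Fin m) ℝ
  M : ℝ → ℝ → Matrix (Fin m) (Fin m) ℝ
  Q : ℝ → ℝ → Matrix (Fin n) (Fin n) ℝ
  S : ℝ → ℝ → Matrix (Fin m) (Fin n) ℝ
  G : ℝ → Matrix (Fin n) (Fin n) ℝ

variable {n m : ℕ}

/-- (H1) -/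
structure H1 (T : ℝ) (c : Coeffs n m) : Prop where
  A_mem : IsL1 T c.A
  B_mem : IsLinfty T c.B

/-- (H2); `Matrix.PosDef` includes symmetry. -/
structure H2 (T : ℝ) (c : Coeffs n m) : Prop where
  M_C1 : IsC1Sq T c.M
  M_pos : ∀ t ∈ Set.Icc 0 T, ∀ s ∈ Set.Icc 0 T, (c.M t s).PosDef

/-- (H3); `Matrix.PosSemidef` includes symmetry. -/
structure H3 (T : ℝ) (c : Coeffs n m) : Prop where
  Q_C1 : IsC1Sq T c.Q
  Q_nonneg : ∀ t ∈ Set.Icc 0 T, ∀ s ∈ Set.Icc 0 T, (c.Q t s).PosSemidef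
  G_C1 : IsC1 T c.G
  G_nonneg : ∀ t ∈ Set.Icc 0 T, (c.G t).PosSemidef

/-- (H4) -/
structure H4 (T : ℝ) (c : Coeffs n m) : Prop where
  S_C1 : IsC1Sq T c.S

/-- (H5). In the last item `K` stands for `M_t⁻¹ S_t`. If `M_t(t,s)` is invertible, then `K` is
forced to be `M_t⁻¹ S_t` and the item says that `Q_t - S_tᵀ M_t⁻¹ S_t` is positive semidefinite.
If `M_t(t,s)` is singular, then `S_tᵀ K` does not depend on the choice of `K`, and the case
`M_t = 0`, `S_t = 0` is covered with `K = 0`. -/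
structure H5 (T : ℝ) (c : Coeffs n m) : Prop where
  Qt_nonneg : ∀ t s : ℝ, 0 ≤ t → t ≤ s → s ≤ T → (dfst T c.Q t s).PosSemidef
  Mt_nonneg : ∀ t s : ℝ, 0 ≤ t → t ≤ s → s ≤ T → (dfst T c.M t s).PosSemidef
  G_dot_nonneg : ∀ t ∈ Set.Icc 0 T, (dot T c.G t).PosSemidef
  schur_nonneg : ∀ t s : ℝ, 0 ≤ t → t ≤ s → s ≤ T →
    (c.Q t s - (c.S t s).transpose * (c.M t s)⁻¹ * c.S t s).PosSemidef
  schur_t_nonneg : ∀ t s : ℝ, 0 ≤ t → t ≤ s → s ≤ T →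
    ∃ K : Matrix (Fin m) (Fin n) ℝ, dfst T c.M t s * K = dfst T c.S t s ∧
      (dfst T c.Q t s - (dfst T c.S t s).transpose * K).PosSemidef

/-- `Υ(s) = M(s,s)⁻¹ (B(s)ᵀ P(s) + S(s,s))`. -/
def Coeffs.Upsilon (c : Coeffs n m) (P : ℝ → Matrix (Fin n) (Fin n) ℝ) (s : ℝ) :
    Matrix (Fin m) (Fin n) ℝ :=
  (c.M s s)⁻¹ * ((c.B s).transpose * P s + c.S s s)

/-- The closed-loop matrix `A(τ) - B(τ) Υ(τ)`. -/
def Coeffs.closedLoop (c : Coeffs n m) (P : ℝ → Matrix (Fin n) (Fin n) ℝ) (τ : ℝ) :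
    Matrix (Fin n) (Fin n) ℝ :=
  c.A τ - c.B τ * c.Upsilon P τ

/-- The nonlocal term `Q̄(t,t)`, for given `P` and `Φ`. -/
def Coeffs.Qbar (c : Coeffs n m) (T : ℝ) (P : ℝ → Matrix (Fin n) (Fin n) ℝ)
    (Φ : ℝ → ℝ → Matrix (Fin n) (Fin n) ℝ) (t : ℝ) : Matrix (Fin n) (Fin n) ℝ :=
  c.Q t t
    - (Φ T t).transpose * dot T c.G t * Φ T t
    - matInt t T (fun s => (Φ s t).transpose * dfst T c.Q t s * Φ s t)
    - matInt t T (fun s => (Φ s t).transpose *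
        ((c.Upsilon P s).transpose * dfst T c.M t s * c.Upsilon P s
          - (c.Upsilon P s).transpose * dfst T c.S t s
          - (dfst T c.S t s).transpose * c.Upsilon P s) * Φ s t)

/-- `P` is a symmetric continuous solution on `[0,T]` of the equilibrium Riccati equation, in
integrated form. Here `Φ` is the state-transition matrix of the closed-loop system of `P`. -/
structure IsRiccatiSolution (T : ℝ) (c : Coeffs n m)
    (P : ℝ → Matrix (Fin n) (Fin n) ℝ) : Prop where
  cont : ContinuousOn P (Set.Icc 0 T)
  symm : ∀ t ∈ Set.Icc 0 T, (P t).IsSymm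
  eqn : ∃ Φ : ℝ → ℝ → Matrix (Fin n) (Fin n) ℝ, IsTransition T (c.closedLoop P) Φ ∧
    ∀ t ∈ Set.Icc 0 T, P t = c.G T + matInt t T (fun s =>
      (c.A s).transpose * P s + P s * c.A s + c.Qbar T P Φ s
        - (P s * c.B s + (c.S s s).transpose) * (c.M s s)⁻¹
          * ((c.B s).transpose * P s + c.S s s))

end EqRiccati

end

/-!
A symmetric `P` solves the equilibrium Riccati equation exactly when it equals the cost-to-go matrix
of the feedback `u = -Υ x` it determines, because both satisfy the same linear Lyapunov equation.
The cost-to-go at time `t` only sees `P` on `[t, T]` and is Lipschitz in `P` on bounded sets, so the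
fixed-point equation is of backward Volterra type: Gronwall's inequality gives uniqueness, and after
radial truncation of `P` a contraction in an exponentially weighted norm gives existence.

The truncation is inactive because of an a priori bound. If `P` is the cost-to-go of the feedback
built from `ρ P` with `ρ` valued in `[0, 1]`, the drift and the quadratic terms enter the equation
for `trace P` with a favourable sign, and what remains is linear, so Gronwall's inequality bounds
`trace P` independently of `ρ`. Positivity of the cost-to-go comes from the Schur complement.
-/

open MeasureTheory

noncomputable section

namespace EqRiccati

open Set
open scoped Matrix

/-! ### Backward Volterra inequalities -/

section Volterra

variable {E : Type*} [NormedAddCommGroup E] {f : ℝ → E} {k w : ℝ → ℝ} {a b s t : ℝ}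

lemma intervalIntegrable_of_mem_Icc (hf : IntegrableOn f (Icc a b)) (hs : s ∈ Icc a b)
    (ht : t ∈ Icc a b) : IntervalIntegrable f volume s t :=
  intervalIntegrable_iff.2 (hf.mono_set (uIoc_subset_uIcc.trans (uIcc_subset_Icc hs ht)))

lemma intervalIntegrable_tail (hf : IntegrableOn f (Icc a b)) (ht : t ∈ Icc a b) :
    IntervalIntegrable f volume t b :=
  intervalIntegrable_of_mem_Icc hf ht (right_mem_Icc.2 (ht.1.trans ht.2))

lemma continuousOn_integral_tail [NormedSpace ℝ E] (hf : IntegrableOn f (Icc a b)) :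
    ContinuousOn (fun t => ∫ s in t..b, f s) (Icc a b) := by
  rcases lt_or_ge b a with hba | hab
  · simp only [Icc_eq_empty_of_lt hba, continuousOn_empty]
  · rw [← uIcc_of_le hab, uIcc_comm] at hf ⊢
    exact (intervalIntegral.continuousOn_primitive_interval hf).neg.congr fun t _ =>
      intervalIntegral.integral_symm b t

lemma antitoneOn_integral_tail (hk : IntegrableOn k (Icc a b)) (hk0 : ∀ s, 0 ≤ k s) :
    AntitoneOn (fun t => ∫ s in t..b, k s) (Icc a b) := fun _ hs _ ht hst =>
  intervalIntegral.integral_mono_interval hst ht.2 le_rfl (ae_of_all _ hk0)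
    (intervalIntegrable_tail hk hs)

lemma integral_mul_exp_tail_le (hk : IntegrableOn k (Icc a b)) (hk0 : ∀ s, 0 ≤ k s)
    (ht : t ∈ Icc a b) :
    ∫ s in t..b, k s * Real.exp (∫ r in s..b, k r) ≤ Real.exp (∫ r in t..b, k r) - 1 := by
  set f : ℝ → ℝ := fun x => -Real.exp (∫ r in x..b, k r) with hf
  have hkt : IntegrableOn k (Icc t b) := hk.mono_set (Icc_subset_Icc_left ht.1)
  have hmono : MonotoneOn f (uIcc t b) := by
    rw [uIcc_of_le ht.2]
    exact fun x hx y hy hxy =>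
      neg_le_neg (Real.exp_le_exp.2 (antitoneOn_integral_tail hkt hk0 hx hy hxy))
  have hderiv : ∀ᵐ x, x ∈ uIcc t b → deriv f x = k x * Real.exp (∫ r in x..b, k r) := by
    filter_upwards [(intervalIntegrable_tail hk ht).ae_hasDerivAt_integral] with x hx hxm
    have htail : HasDerivAt (fun x => ∫ r in x..b, k r) (-k x) x := by
      simpa only [← intervalIntegral.integral_symm] using (hx hxm b right_mem_uIcc).fun_neg
    rw [htail.exp.fun_neg.deriv]
    ring
  have hint : ∫ x in t..b, deriv f x = ∫ s in t..b, k s * Real.exp (∫ r in s..b, k r) := by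
    refine intervalIntegral.integral_congr_ae ?_
    filter_upwards [hderiv] with x hx hxm using hx (uIoc_subset_uIcc hxm)
  have hmem := hmono.intervalIntegral_deriv_mem_uIcc
  have hle : f t ≤ f b := hmono left_mem_uIcc right_mem_uIcc ht.2
  rw [hint, uIcc_of_le (sub_nonneg.2 hle)] at hmem
  refine hmem.2.trans_eq ?_
  simp only [hf, intervalIntegral.integral_same, Real.exp_zero]
  ring

lemma integral_mul_le_of_le_mul_exp_tail {C : ℝ} (hk : IntegrableOn k (Icc a b))
    (hk0 : ∀ s, 0 ≤ k s) (hw : ContinuousOn w (Icc a b)) (hC : 0 ≤ C)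
    (h : ∀ s ∈ Icc a b, w s ≤ C * Real.exp (∫ r in s..b, k r)) (ht : t ∈ Icc a b) :
    ∫ s in t..b, k s * w s ≤ C * (Real.exp (∫ r in t..b, k r) - 1) := by
  have hkw : IntegrableOn (fun s => k s * w s) (Icc a b) := hk.mul_continuousOn hw isCompact_Icc
  have hke : IntegrableOn (fun s => k s * Real.exp (∫ r in s..b, k r)) (Icc a b) :=
    hk.mul_continuousOn (continuousOn_integral_tail hk).rexp isCompact_Icc
  calc ∫ s in t..b, k s * w s
      ≤ ∫ s in t..b, C * (k s * Real.exp (∫ r in s..b, k r)) := by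
        refine intervalIntegral.integral_mono_on ht.2 (intervalIntegrable_tail hkw ht)
          ((intervalIntegrable_tail hke ht).const_mul C) fun s hs => ?_
        rw [mul_left_comm]
        exact mul_le_mul_of_nonneg_left (h s ⟨ht.1.trans hs.1, hs.2⟩) (hk0 s)
    _ = C * ∫ s in t..b, k s * Real.exp (∫ r in s..b, k r) :=
        intervalIntegral.integral_const_mul _ _
    _ ≤ C * (Real.exp (∫ r in t..b, k r) - 1) :=
        mul_le_mul_of_nonneg_left (integral_mul_exp_tail_le hk hk0 ht) hC

lemma le_mul_exp_of_le_add_integral {c : ℝ} (hk : IntegrableOn k (Icc a b)) (hk0 : ∀ s, 0 ≤ k s)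
    (hw : ContinuousOn w (Icc a b)) (hc : 0 ≤ c)
    (h : ∀ t ∈ Icc a b, w t ≤ c + ∫ s in t..b, k s * w s) (ht : t ∈ Icc a b) :
    w t ≤ c * Real.exp (∫ r in t..b, k r) := by
  set e : ℝ → ℝ := fun t => Real.exp (∫ r in t..b, k r)
  have hepos : ∀ t, 0 < e t := fun t => Real.exp_pos _
  obtain ⟨x, hx, hmax⟩ := isCompact_Icc.exists_isMaxOn ⟨t, ht⟩
    (hw.div (continuousOn_integral_tail hk).rexp fun t _ => (hepos t).ne')
  set W := w x / e x
  have hwW : ∀ s ∈ Icc a b, w s ≤ W * e s := fun s hs => (div_le_iff₀ (hepos s)).1 (hmax hs)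
  suffices hWc : W ≤ c from (hwW t ht).trans (mul_le_mul_of_nonneg_right hWc (hepos t).le)
  rcases le_or_gt W 0 with hW0 | hW0
  · exact hW0.trans hc
  · have hwx : W * e x = w x := div_mul_cancel₀ _ (hepos x).ne'
    have hint := integral_mul_le_of_le_mul_exp_tail hk hk0 hw hW0.le hwW hx
    linarith [h x hx]

/-- The contraction is measured in the Bielecki norm
`sup_t exp (-2 ∫ₜᵇ k) ‖u t‖`, for which the Lipschitz constant is at most `1 / 2`. -/
lemma exists_fixedPoint_of_norm_sub_le_integral [NormedSpace ℝ E] [CompleteSpace E] (hab : a ≤ b)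
    (hk : IntegrableOn k (Icc a b)) (hk0 : ∀ s, 0 ≤ k s) (Γ : (ℝ → E) → ℝ → E)
    (hcont : ∀ u, ContinuousOn u (Icc a b) → ContinuousOn (Γ u) (Icc a b))
    (hlip : ∀ u v, ContinuousOn u (Icc a b) → ContinuousOn v (Icc a b) → ∀ t ∈ Icc a b,
      ‖Γ u t - Γ v t‖ ≤ ∫ s in t..b, k s * ‖u s - v s‖) :
    ∃ u, ContinuousOn u (Icc a b) ∧ ∀ t ∈ Icc a b, u t = Γ u t := by
  set e : ℝ → ℝ := fun t => Real.exp (∫ r in t..b, 2 * k r)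
  have hec : ContinuousOn e (Icc a b) := (continuousOn_integral_tail (hk.const_mul 2)).rexp
  have hepos : ∀ t, 0 < e t := fun t => Real.exp_pos _
  let weight : C(Icc a b, E) → ℝ → E := fun v t => e t • v (projIcc a b hab t)
  have hweight : ∀ v, ContinuousOn (weight v) (Icc a b) := fun v =>
    hec.smul (v.continuous.comp continuous_projIcc).continuousOn
  let Λ : C(Icc a b, E) → C(Icc a b, E) := fun v =>
    ⟨fun t => (e t)⁻¹ • Γ (weight v) t, continuousOn_iff_continuous_domRestrict.1
      ((hec.inv₀ fun t _ => (hepos t).ne').smul (hcont _ (hweight v)))⟩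
  have hΛ : ContractingWith (1 / 2 : NNReal) Λ := by
    refine ⟨by rw [div_lt_one] <;> norm_num, LipschitzWith.of_dist_le_mul fun u v => ?_⟩
    rw [ContinuousMap.dist_le (by positivity)]
    intro t
    have hdist : ∀ s ∈ Icc a b, ‖weight u s - weight v s‖ ≤ dist u v * e s := fun s _ => by
      rw [← smul_sub, norm_smul, Real.norm_of_nonneg (hepos s).le, ← dist_eq_norm, mul_comm]
      exact mul_le_mul_of_nonneg_right (ContinuousMap.dist_apply_le_dist _) (hepos s).le
    have hint := integral_mul_le_of_le_mul_exp_tail (hk.const_mul 2)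
      (fun s => mul_nonneg zero_le_two (hk0 s)) ((hweight u).fun_sub (hweight v)).norm
      dist_nonneg hdist t.2
    simp only [mul_assoc (2 : ℝ)] at hint
    rw [intervalIntegral.integral_const_mul] at hint
    have hΓ := hlip _ _ (hweight u) (hweight v) t t.2
    change dist ((e t)⁻¹ • Γ (weight u) t) ((e t)⁻¹ • Γ (weight v) t) ≤ _
    rw [dist_eq_norm, ← smul_sub, norm_smul, norm_inv, Real.norm_of_nonneg (hepos t).le,
      inv_mul_le_iff₀ (hepos t)]
    push_cast
    have hdist0 : 0 ≤ dist u v := dist_nonneg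
    linarith
  obtain ⟨v, hv, -⟩ := hΛ.exists_fixedPoint 0 (edist_ne_top _ _)
  refine ⟨weight v, hweight v, fun t ht => ?_⟩
  have hvt : (e t)⁻¹ • Γ (weight v) t = v ⟨t, ht⟩ := DFunLike.congr_fun hv ⟨t, ht⟩
  simp only [weight, projIcc_of_mem hab ht]
  rw [← hvt, smul_inv_smul₀ (hepos t).ne']

end Volterra

/-! ### Matrix-valued functions -/

open scoped MatrixOrder in
lemma exists_eq_transpose_mul_self {p : Type*} [Fintype p] {A : Matrix p p ℝ}
    (hA : A.PosSemidef) : ∃ C : Matrix p p ℝ, A = Cᵀ * C := by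
  classical
  obtain ⟨C, rfl⟩ := CStarAlgebra.nonneg_iff_eq_star_mul_self.1 (Matrix.nonneg_iff_posSemidef.2 hA)
  exact ⟨C, by rw [Matrix.star_eq_conjTranspose, Matrix.conjTranspose_eq_transpose_of_trivial]⟩

open scoped Matrix.Norms.Frobenius

/- The Frobenius norm is scoped without replacing the entrywise topology of `Matrix`; these
instances make the norm topology, which is definitionally the same, the preferred one. -/

scoped instance (priority := 2000) frobeniusUniformSpace {p q : Type*} [Fintype p] [Fintype q] :
    UniformSpace (Matrix p q ℝ) := PseudoMetricSpace.toUniformSpace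

scoped instance (priority := 2000) frobeniusTopologicalSpace {p q : Type*} [Fintype p]
    [Fintype q] : TopologicalSpace (Matrix p q ℝ) :=
  PseudoMetricSpace.toUniformSpace.toTopologicalSpace

scoped instance frobeniusCompleteSpace {p q : Type*} [Fintype p] [Fintype q] :
    CompleteSpace (Matrix p q ℝ) := FiniteDimensional.complete ℝ _

section Matrices

variable {p q r : Type*} [Fintype p] [Fintype q] [Fintype r]

/-- The entry of a matrix in row `i` and column `j`, as a continuous linear functional. -/
def entryCLM (i : p) (j : q) : Matrix p q ℝ →L[ℝ] ℝ :=
  (Matrix.entryLinearMap ℝ ℝ i j).toContinuousLinearMap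

@[simp] lemma entryCLM_apply (i : p) (j : q) (F : Matrix p q ℝ) : entryCLM i j F = F i j := rfl

/-- Transposition, as a continuous linear map. -/
def transposeCLM : Matrix p q ℝ →L[ℝ] Matrix q p ℝ :=
  (Matrix.transposeLinearEquiv p q ℝ ℝ).toLinearMap.toContinuousLinearMap

@[simp] lemma transposeCLM_apply (F : Matrix p q ℝ) : transposeCLM F = Fᵀ := rfl

/-- The trace, as a continuous linear functional. -/
def traceCLM : Matrix p p ℝ →L[ℝ] ℝ := (Matrix.traceLinearMap p ℝ ℝ).toContinuousLinearMap

@[simp] lemma traceCLM_apply (F : Matrix p p ℝ) : traceCLM F = F.trace := rfl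

/-- The map `F ↦ L F R`, as a continuous linear map. -/
def mulLeftRightCLM {u : Type*} [Fintype u] (L : Matrix p q ℝ) (R : Matrix r u ℝ) :
    Matrix q r ℝ →L[ℝ] Matrix p u ℝ :=
  LinearMap.toContinuousLinearMap
    { toFun := fun F => L * F * R
      map_add' := fun F G => by rw [Matrix.mul_add, Matrix.add_mul]
      map_smul' := fun c F => by rw [Matrix.mul_smul, Matrix.smul_mul, RingHom.id_apply] }

@[simp] lemma mulLeftRightCLM_apply {u : Type*} [Fintype u] (L : Matrix p q ℝ) (R : Matrix r u ℝ)
    (F : Matrix q r ℝ) : mulLeftRightCLM L R F = L * F * R := rfl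

section Topology

variable {α : Type*} [TopologicalSpace α] {s : Set α} {F : α → Matrix p q ℝ}
  {G : α → Matrix q r ℝ}

lemma continuousOn_matrix_iff : ContinuousOn F s ↔ ∀ i j, ContinuousOn (fun x => F x i j) s :=
  ⟨fun h i j => (entryCLM i j).continuous.comp_continuousOn h,
    fun h => continuousOn_pi.2 fun i => continuousOn_pi.2 fun j => h i j⟩

lemma continuous_matrix_mul :
    Continuous (fun x : Matrix p q ℝ × Matrix q r ℝ => x.1 * x.2) :=
  Continuous.matrix_mul continuous_fst continuous_snd

lemma continuousOn_matrix_mul (hF : ContinuousOn F s) (hG : ContinuousOn G s) :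
    ContinuousOn (fun x => F x * G x) s :=
  continuous_matrix_mul.comp_continuousOn (hF.prodMk hG)

end Topology

section Measure

variable {α : Type*} [MeasurableSpace α] {μ : Measure α} {F : α → Matrix p q ℝ}
  {G : α → Matrix q r ℝ}

lemma memLp_matrix_iff {P : ENNReal} : MemLp F P μ ↔ ∀ i j, MemLp (fun x => F x i j) P μ := by
  classical
  refine ⟨fun h i j => (entryCLM i j).comp_memLp' h, fun h => ?_⟩
  have hsum : MemLp (fun x => ∑ i, ∑ j, F x i j • Matrix.single i j (1 : ℝ)) P μ :=
    memLp_finsetSum _ fun i _ => memLp_finsetSum _ fun j _ =>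
      (ContinuousLinearMap.toSpanSingleton ℝ (Matrix.single i j (1 : ℝ))).comp_memLp' (h i j)
  convert hsum using 2 with x
  simpa using Matrix.matrix_eq_sum_single (F x)

lemma memLp_matrix_mul {P Q R : ENNReal} [ENNReal.HolderTriple P Q R]
    (hF : MemLp F P μ) (hG : MemLp G Q μ) : MemLp (fun x => F x * G x) R μ := by
  refine MemLp.of_bilin (fun A B => A * B) 1 hF hG ?_ (ae_of_all _ fun x => ?_)
  · exact continuous_matrix_mul.comp_aestronglyMeasurable
      (hF.aestronglyMeasurable.prodMk hG.aestronglyMeasurable)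
  · simpa using Matrix.frobenius_nnnorm_mul (F x) (G x)

lemma memLp_top_matrix_mul (hF : MemLp F ⊤ μ) (hG : MemLp G ⊤ μ) :
    MemLp (fun x => F x * G x) ⊤ μ :=
  memLp_matrix_mul hF hG

lemma memLp_matrix_transpose {P : ENNReal} (hF : MemLp F P μ) : MemLp (fun x => (F x)ᵀ) P μ :=
  (transposeCLM (p := p) (q := q)).comp_memLp' hF

lemma integrable_matrix_mul_of_memLp_top (hF : Integrable F μ) (hG : MemLp G ⊤ μ) :
    Integrable (fun x => F x * G x) μ :=
  memLp_one_iff_integrable.1 (memLp_matrix_mul (memLp_one_iff_integrable.2 hF) hG)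

lemma integrable_neg_transpose (hF : Integrable F μ) : Integrable (fun x => -(F x)ᵀ) μ :=
  ((transposeCLM (p := p) (q := q)).integrable_comp hF).neg

end Measure

end Matrices

lemma exists_ae_norm_le_of_memLp_top {α E : Type*} [MeasurableSpace α] {μ : Measure α}
    [NormedAddCommGroup E] {F : α → E} (hF : MemLp F ⊤ μ) :
    ∃ C, 0 ≤ C ∧ ∀ᵐ x ∂μ, ‖F x‖ ≤ C :=
  ⟨lpNorm F ⊤ μ, lpNorm_nonneg, ae_le_lpNorm_exponent_top hF⟩

lemma memLp_top_of_continuousOn {β E : Type*} [TopologicalSpace β] [MeasurableSpace β]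
    [OpensMeasurableSpace β] [SecondCountableTopology β] [T2Space β]
    {ν : Measure β} [NormedAddCommGroup E] {F : β → E} {s : Set β} (hs : IsCompact s)
    (hF : ContinuousOn F s) : MemLp F ⊤ (ν.restrict s) := by
  obtain ⟨C, hC⟩ := hs.exists_bound_of_continuousOn hF
  exact memLp_top_of_bound (hF.aestronglyMeasurable hs.measurableSet) C
    ((ae_restrict_iff' hs.measurableSet).2 (ae_of_all _ hC))

/-! ### Primitives of integrable functions -/

/-- `F` is a primitive of the integrable function `f` on `[a,b]`, in the Carathéodory sense: this
is how differential equations with merely integrable coefficients are stated. -/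
structure IsPrimitive {E : Type*} [NormedAddCommGroup E] [NormedSpace ℝ E] (a b : ℝ)
    (F f : ℝ → E) : Prop where
  integrable : IntegrableOn f (Icc a b)
  eq_add : ∀ s ∈ Icc a b, ∀ t ∈ Icc a b, F t = F s + ∫ r in s..t, f r

namespace IsPrimitive

variable {E E' : Type*} [NormedAddCommGroup E] [NormedSpace ℝ E] [NormedAddCommGroup E']
  [NormedSpace ℝ E'] {a b s t : ℝ} {F f G g : ℝ → E}

lemma of_eq_add {x : E} (hf : IntegrableOn f (Icc a b)) (hs : s ∈ Icc a b)
    (h : ∀ t ∈ Icc a b, F t = x + ∫ r in s..t, f r) : IsPrimitive a b F f where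
  integrable := hf
  eq_add r hr t ht := by
    rw [h r hr, h t ht, add_assoc, intervalIntegral.integral_add_adjacent_intervals
      (intervalIntegrable_of_mem_Icc hf hs hr) (intervalIntegrable_of_mem_Icc hf hr ht)]

lemma of_eq_sub_tail {x : E} (hf : IntegrableOn f (Icc a b)) (hab : a ≤ b)
    (h : ∀ t ∈ Icc a b, F t = x - ∫ r in t..b, f r) : IsPrimitive a b F f :=
  of_eq_add hf (right_mem_Icc.2 hab) fun t ht => by
    rw [h t ht, intervalIntegral.integral_symm, sub_neg_eq_add]

lemma eq_sub_tail (h : IsPrimitive a b F f) (ht : t ∈ Icc a b) :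
    F t = F b - ∫ s in t..b, f s :=
  eq_sub_of_add_eq (h.eq_add t ht b (right_mem_Icc.2 (ht.1.trans ht.2))).symm

lemma continuousOn (h : IsPrimitive a b F f) : ContinuousOn F (Icc a b) :=
  (continuousOn_const.sub (continuousOn_integral_tail h.integrable)).congr fun _ => h.eq_sub_tail

lemma congr {F' f' : ℝ → E} (h : IsPrimitive a b F f) (hF : EqOn F F' (Icc a b))
    (hf : EqOn f f' (Icc a b)) : IsPrimitive a b F' f' where
  integrable := h.integrable.congr_fun hf measurableSet_Icc
  eq_add s hs t ht := by
    rw [← hF hs, ← hF ht, h.eq_add s hs t ht,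
      intervalIntegral.integral_congr (hf.mono (uIcc_subset_Icc hs ht))]

lemma clm_comp [CompleteSpace E] [CompleteSpace E'] (h : IsPrimitive a b F f) (L : E →L[ℝ] E') :
    IsPrimitive a b (fun t => L (F t)) (fun t => L (f t)) where
  integrable := L.integrable_comp h.integrable
  eq_add s hs t ht := by
    rw [h.eq_add s hs t ht, map_add,
      L.intervalIntegral_comp_comm (intervalIntegrable_of_mem_Icc h.integrable hs ht)]

lemma add (hF : IsPrimitive a b F f) (hG : IsPrimitive a b G g) :
    IsPrimitive a b (fun t => F t + G t) (fun t => f t + g t) where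
  integrable := hF.integrable.add hG.integrable
  eq_add s hs t ht := by
    rw [intervalIntegral.integral_add (intervalIntegrable_of_mem_Icc hF.integrable hs ht)
      (intervalIntegrable_of_mem_Icc hG.integrable hs ht), hF.eq_add s hs t ht,
      hG.eq_add s hs t ht, add_add_add_comm]

lemma sub (hF : IsPrimitive a b F f) (hG : IsPrimitive a b G g) :
    IsPrimitive a b (fun t => F t - G t) (fun t => f t - g t) where
  integrable := hF.integrable.sub hG.integrable
  eq_add s hs t ht := by
    rw [intervalIntegral.integral_sub (intervalIntegrable_of_mem_Icc hF.integrable hs ht)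
      (intervalIntegrable_of_mem_Icc hG.integrable hs ht), hF.eq_add s hs t ht,
      hG.eq_add s hs t ht, add_sub_add_comm]

lemma finset_sum {ι : Type*} (u : Finset ι) {F f : ι → ℝ → E}
    (h : ∀ i ∈ u, IsPrimitive a b (F i) (f i)) :
    IsPrimitive a b (fun t => ∑ i ∈ u, F i t) (fun t => ∑ i ∈ u, f i t) where
  integrable := integrable_finsetSum _ fun i hi => (h i hi).integrable
  eq_add s hs t ht := by
    rw [intervalIntegral.integral_finsetSum fun i hi =>
      intervalIntegrable_of_mem_Icc (h i hi).integrable hs ht, ← Finset.sum_add_distrib]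
    exact Finset.sum_congr rfl fun i hi => (h i hi).eq_add s hs t ht

lemma exists_absolutelyContinuousOnInterval {F f : ℝ → ℝ} (h : IsPrimitive a b F f)
    (hab : a ≤ b) : ∃ F' : ℝ → ℝ, AbsolutelyContinuousOnInterval F' a b ∧
      EqOn F' F (Icc a b) ∧ ∀ᵐ x, x ∈ Icc a b → deriv F' x = f x := by
  have ha : a ∈ Icc a b := left_mem_Icc.2 hab
  have hf := intervalIntegrable_tail h.integrable ha
  refine ⟨fun x => F a + ∫ s in a..x, f s, ?_, fun x hx => (h.eq_add a ha x hx).symm, ?_⟩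
  · exact ((LipschitzWith.const (F a)).lipschitzOnWith.absolutelyContinuousOnInterval).fun_add
      (hf.absolutelyContinuousOnInterval_intervalIntegral left_mem_uIcc)
  · filter_upwards [hf.ae_hasDerivAt_integral] with x hx hxm
    rw [uIcc_of_le hab] at hx
    exact ((hx hxm a ha).const_add (F a)).deriv

lemma mul_real {F f G g : ℝ → ℝ} (hF : IsPrimitive a b F f) (hG : IsPrimitive a b G g) :
    IsPrimitive a b (fun t => F t * G t) (fun t => f t * G t + F t * g t) where
  integrable := (hF.integrable.mul_continuousOn hG.continuousOn isCompact_Icc).add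
    (hG.integrable.continuousOn_mul hF.continuousOn isCompact_Icc)
  eq_add s hs t ht := by
    have hab : a ≤ b := hs.1.trans hs.2
    have hsub : uIcc s t ⊆ Icc a b := uIcc_subset_Icc hs ht
    have hsub' : uIcc s t ⊆ uIcc a b := by rwa [uIcc_of_le hab]
    obtain ⟨F', hF'ac, hF'F, hF'deriv⟩ := hF.exists_absolutelyContinuousOnInterval hab
    obtain ⟨G', hG'ac, hG'G, hG'deriv⟩ := hG.exists_absolutelyContinuousOnInterval hab
    have hparts : ∫ r in s..t, f r * G r + F r * g r = F' t * G' t - F' s * G' s := by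
      rw [← (hF'ac.mono hsub').integral_deriv_mul_eq_sub (hG'ac.mono hsub')]
      refine intervalIntegral.integral_congr_ae ?_
      filter_upwards [hF'deriv, hG'deriv] with x hFx hGx hx
      have hx' := hsub (uIoc_subset_uIcc hx)
      rw [hFx hx', hGx hx', hF'F hx', hG'G hx']
    rw [hparts, hF'F hs, hG'G hs, hF'F ht, hG'G ht, add_sub_cancel]

variable {p q r : Type*} [Fintype p] [Fintype q] [Fintype r]

lemma of_entries {F f : ℝ → Matrix p q ℝ}
    (h : ∀ i j, IsPrimitive a b (fun t => F t i j) (fun t => f t i j)) : IsPrimitive a b F f := by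
  have hf : IntegrableOn f (Icc a b) := memLp_one_iff_integrable.1
    (memLp_matrix_iff.2 fun i j => memLp_one_iff_integrable.2 (h i j).integrable)
  refine ⟨hf, fun s hs t ht => ?_⟩
  ext i j
  have hentry := (entryCLM i j).intervalIntegral_comp_comm (intervalIntegrable_of_mem_Icc hf hs ht)
  simp only [entryCLM_apply] at hentry
  rw [Matrix.add_apply, ← hentry, (h i j).eq_add s hs t ht]

lemma mul {F f : ℝ → Matrix p q ℝ} {G g : ℝ → Matrix q r ℝ} (hF : IsPrimitive a b F f)
    (hG : IsPrimitive a b G g) :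
    IsPrimitive a b (fun t => F t * G t) (fun t => f t * G t + F t * g t) := by
  refine of_entries fun i j => ?_
  simp only [Matrix.mul_apply, Matrix.add_apply, ← Finset.sum_add_distrib]
  exact finset_sum _ fun l _ => (hF.clm_comp (entryCLM i l)).mul_real (hG.clm_comp (entryCLM l j))

lemma transpose {F f : ℝ → Matrix p q ℝ} (hF : IsPrimitive a b F f) :
    IsPrimitive a b (fun t => (F t)ᵀ) (fun t => (f t)ᵀ) :=
  hF.clm_comp transposeCLM

lemma mul_const {F f : ℝ → Matrix p q ℝ} (hF : IsPrimitive a b F f)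
    (R : Matrix q r ℝ) : IsPrimitive a b (fun t => F t * R) (fun t => f t * R) := by
  classical
  simpa only [mulLeftRightCLM_apply, Matrix.one_mul]
    using hF.clm_comp (mulLeftRightCLM (1 : Matrix p p ℝ) R)

lemma norm_le_mul_exp (h : IsPrimitive a b F f) {e k : ℝ → ℝ} (he : IntegrableOn e (Icc a b))
    (he0 : ∀ s, 0 ≤ e s) (hk : IntegrableOn k (Icc a b)) (hk0 : ∀ s, 0 ≤ k s)
    (hf : ∀ s ∈ Icc a b, ‖f s‖ ≤ e s + k s * ‖F s‖) (ht : t ∈ Icc a b) :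
    ‖F t‖ ≤ (‖F b‖ + ∫ s in t..b, e s) * Real.exp (∫ s in t..b, k s) := by
  have hsub : Icc t b ⊆ Icc a b := Icc_subset_Icc_left ht.1
  refine le_mul_exp_of_le_add_integral (hk.mono_set hsub) hk0 (h.continuousOn.norm.mono hsub)
    (add_nonneg (norm_nonneg _) (intervalIntegral.integral_nonneg_of_forall ht.2 he0))
    (fun x hx => ?_) (left_mem_Icc.2 ht.2)
  have hx' := hsub hx
  have hex := intervalIntegrable_tail he hx'
  have hkx := intervalIntegrable_tail
    (hk.mul_continuousOn h.continuousOn.norm isCompact_Icc) hx'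
  calc ‖F x‖ ≤ ‖F b‖ + ‖∫ s in x..b, f s‖ := by
        rw [h.eq_sub_tail hx']
        exact norm_sub_le _ _
    _ ≤ ‖F b‖ + ∫ s in x..b, (e s + k s * ‖F s‖) := by
        gcongr
        exact intervalIntegral.norm_integral_le_of_norm_le hx.2
          (ae_of_all _ fun s hs => hf s ⟨hx'.1.trans hs.1.le, hs.2⟩) (hex.add hkx)
    _ = (‖F b‖ + ∫ s in x..b, e s) + ∫ s in x..b, k s * ‖F s‖ := by
        rw [intervalIntegral.integral_add hex hkx, add_assoc]
    _ ≤ (‖F b‖ + ∫ s in t..b, e s) + ∫ s in x..b, k s * ‖F s‖ := by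
        gcongr
        exact antitoneOn_integral_tail he he0 ht hx' hx.1

lemma eq_zero_of_norm_le (h : IsPrimitive a b F f) {k : ℝ → ℝ}
    (hk : IntegrableOn k (Icc a b)) (hk0 : ∀ s, 0 ≤ k s)
    (hf : ∀ s ∈ Icc a b, ‖f s‖ ≤ k s * ‖F s‖) (hFb : F b = 0) (ht : t ∈ Icc a b) :
    F t = 0 := by
  simpa [hFb] using h.norm_le_mul_exp (e := 0) integrableOn_zero (fun _ => le_rfl) hk hk0
    (fun s hs => by simpa using hf s hs) ht

end IsPrimitive

/-! ### Linear systems with integrable coefficients -/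

lemma norm_mul_sub_mul_le {p q r : Type*} [Fintype p] [Fintype q] [Fintype r]
    (F F' : Matrix p q ℝ) (G G' : Matrix q r ℝ) :
    ‖F * G - F' * G'‖ ≤ ‖F - F'‖ * ‖G‖ + ‖F'‖ * ‖G - G'‖ := by
  rw [← sub_add_sub_cancel (F * G) (F' * G), ← Matrix.sub_mul, ← Matrix.mul_sub]
  exact norm_add_le_of_le (Matrix.frobenius_norm_mul _ _) (Matrix.frobenius_norm_mul _ _)

lemma norm_neg_transpose {p q : Type*} [Fintype p] [Fintype q] (F : Matrix p q ℝ) :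
    ‖-Fᵀ‖ = ‖F‖ := by
  rw [norm_neg, Matrix.frobenius_norm_transpose]

section LinearSystem

variable {p q : Type*} [Fintype p] [Fintype q] {T L t : ℝ} {A B : ℝ → Matrix p p ℝ}

lemma integrableOn_matrix_mul_continuousOn {F : ℝ → Matrix p q ℝ}
    (hA : IntegrableOn A (Icc 0 T)) (hF : ContinuousOn F (Icc 0 T)) :
    IntegrableOn (fun s => A s * F s) (Icc 0 T) :=
  integrable_matrix_mul_of_memLp_top hA (memLp_top_of_continuousOn isCompact_Icc hF)

variable [DecidableEq p]

lemma exists_isPrimitive_mul (hT : 0 ≤ T) (hA : IntegrableOn A (Icc 0 T)) :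
    ∃ X : ℝ → Matrix p p ℝ, IsPrimitive 0 T X (fun s => A s * X s) ∧ X T = 1 := by
  obtain ⟨X, hXc, hX⟩ := exists_fixedPoint_of_norm_sub_le_integral hT hA.norm
    (fun s => norm_nonneg (A s)) (fun (u : ℝ → Matrix p p ℝ) t => 1 - ∫ s in t..T, A s * u s)
    (fun u hu => continuousOn_const.sub
      (continuousOn_integral_tail (integrableOn_matrix_mul_continuousOn hA hu)))
    (fun u v hu hv t ht => by
      rw [sub_sub_sub_cancel_left, norm_sub_rev, ← intervalIntegral.integral_sub
        (intervalIntegrable_tail (integrableOn_matrix_mul_continuousOn hA hu) ht)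
        (intervalIntegrable_tail (integrableOn_matrix_mul_continuousOn hA hv) ht)]
      refine intervalIntegral.norm_integral_le_of_norm_le ht.2 (ae_of_all _ fun s _ => ?_)
        (intervalIntegrable_tail
          (IntegrableOn.mul_continuousOn hA.norm (hu.sub hv).norm isCompact_Icc) ht)
      rw [← Matrix.mul_sub]
      exact Matrix.frobenius_norm_mul _ _)
  exact ⟨X, .of_eq_sub_tail (integrableOn_matrix_mul_continuousOn hA hXc) hT hX,
    by simpa using hX T (right_mem_Icc.2 hT)⟩

/-- The fundamental matrix of `X' = A X` on `[0,T]`, normalised by `X(T) = 1`. It is only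
meaningful for integrable `A`. -/
def fundSol (T : ℝ) (A : ℝ → Matrix p p ℝ) : ℝ → Matrix p p ℝ :=
  Classical.epsilon fun X => IsPrimitive 0 T X (fun s => A s * X s) ∧ X T = 1

section

variable (hT : 0 ≤ T) (hA : IntegrableOn A (Icc 0 T))

include hT hA

lemma isPrimitive_fundSol : IsPrimitive 0 T (fundSol T A) (fun s => A s * fundSol T A s) :=
  (Classical.epsilon_spec (exists_isPrimitive_mul hT hA)).1

lemma fundSol_right : fundSol T A T = 1 :=
  (Classical.epsilon_spec (exists_isPrimitive_mul hT hA)).2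

lemma isPrimitive_transpose_fundSol_neg_transpose :
    IsPrimitive 0 T (fun s => (fundSol T (fun r => -(A r)ᵀ) s)ᵀ)
      (fun s => -((fundSol T (fun r => -(A r)ᵀ) s)ᵀ * A s)) :=
  (isPrimitive_fundSol hT (integrable_neg_transpose hA)).transpose.congr (eqOn_refl _ _)
    fun s _ => by
      simp only [Matrix.transpose_mul, Matrix.transpose_neg, Matrix.transpose_transpose,
        Matrix.mul_neg]

lemma transpose_fundSol_neg_transpose_mul_fundSol (ht : t ∈ Icc 0 T) :
    (fundSol T (fun s => -(A s)ᵀ) t)ᵀ * fundSol T A t = 1 := by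
  have hconst := ((isPrimitive_transpose_fundSol_neg_transpose hT hA).mul
    (isPrimitive_fundSol hT hA)).congr (f' := 0) (eqOn_refl _ _) fun s _ => by
      simp only [Matrix.neg_mul, Matrix.mul_assoc, neg_add_cancel, Pi.zero_apply]
  simpa [fundSol_right hT hA, fundSol_right hT (integrable_neg_transpose hA)]
    using hconst.eq_sub_tail ht

lemma fundSol_inv (ht : t ∈ Icc 0 T) :
    (fundSol T A t)⁻¹ = (fundSol T (fun s => -(A s)ᵀ) t)ᵀ :=
  Matrix.inv_eq_left_inv (transpose_fundSol_neg_transpose_mul_fundSol hT hA ht)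

lemma fundSol_inv_mul_fundSol (ht : t ∈ Icc 0 T) : (fundSol T A t)⁻¹ * fundSol T A t = 1 := by
  rw [fundSol_inv hT hA ht, transpose_fundSol_neg_transpose_mul_fundSol hT hA ht]

lemma fundSol_mul_fundSol_inv (ht : t ∈ Icc 0 T) : fundSol T A t * (fundSol T A t)⁻¹ = 1 :=
  mul_eq_one_comm.1 (fundSol_inv_mul_fundSol hT hA ht)

lemma isPrimitive_fundSol_inv :
    IsPrimitive 0 T (fun s => (fundSol T A s)⁻¹) (fun s => -((fundSol T A s)⁻¹ * A s)) :=
  (isPrimitive_transpose_fundSol_neg_transpose hT hA).congr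
    (fun s hs => (fundSol_inv hT hA hs).symm) fun s hs => by rw [fundSol_inv hT hA hs]

lemma exp_integral_norm_le (hL : ∫ s in 0..T, ‖A s‖ ≤ L) (ht : t ∈ Icc 0 T) :
    Real.exp (∫ s in t..T, ‖A s‖) ≤ Real.exp L :=
  Real.exp_le_exp.2 ((antitoneOn_integral_tail hA.norm (fun s => norm_nonneg (A s))
    (left_mem_Icc.2 hT) ht ht.1).trans hL)

lemma norm_fundSol_le (hL : ∫ s in 0..T, ‖A s‖ ≤ L) (ht : t ∈ Icc 0 T) :
    ‖fundSol T A t‖ ≤ ‖(1 : Matrix p p ℝ)‖ * Real.exp L := by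
  have hgronwall := (isPrimitive_fundSol hT hA).norm_le_mul_exp (e := 0) integrableOn_zero
    (fun _ => le_rfl) hA.norm (fun s => norm_nonneg (A s))
    (fun s _ => by simpa using Matrix.frobenius_norm_mul _ _) ht
  simp only [fundSol_right hT hA, Pi.zero_apply, intervalIntegral.integral_zero, add_zero]
    at hgronwall
  exact hgronwall.trans
    (mul_le_mul_of_nonneg_left (exp_integral_norm_le hT hA hL ht) (norm_nonneg _))

lemma norm_fundSol_sub_le (hB : IntegrableOn B (Icc 0 T)) (hAL : ∫ s in 0..T, ‖A s‖ ≤ L)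
    (hBL : ∫ s in 0..T, ‖B s‖ ≤ L) (ht : t ∈ Icc 0 T) :
    ‖fundSol T A t - fundSol T B t‖
      ≤ ‖(1 : Matrix p p ℝ)‖ * Real.exp L ^ 2 * ∫ s in t..T, ‖A s - B s‖ := by
  set x := ‖(1 : Matrix p p ℝ)‖ * Real.exp L with hx
  have : 0 ≤ x := by positivity
  have hI0 : 0 ≤ ∫ s in t..T, ‖A s - B s‖ :=
    intervalIntegral.integral_nonneg_of_forall ht.2 fun s => norm_nonneg _
  have hderiv : ∀ s ∈ Icc 0 T, ‖A s * fundSol T A s - B s * fundSol T B s‖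
      ≤ x * ‖A s - B s‖ + ‖A s‖ * ‖fundSol T A s - fundSol T B s‖ := fun s hs => by
    have hXB := norm_fundSol_le hT hB hBL hs
    rw [norm_sub_rev, norm_sub_rev (A s) (B s), norm_sub_rev (fundSol T A s)]
    refine (norm_mul_sub_mul_le _ _ _ _).trans (add_le_add_left ?_ _)
    rw [mul_comm x]
    exact mul_le_mul_of_nonneg_left hXB (norm_nonneg _)
  have hgronwall := ((isPrimitive_fundSol hT hA).sub (isPrimitive_fundSol hT hB)).norm_le_mul_exp
    ((hA.sub hB).norm.const_mul x) (fun s => by positivity) hA.norm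
    (fun s => norm_nonneg (A s)) hderiv ht
  rw [fundSol_right hT hA, fundSol_right hT hB, sub_self, norm_zero, zero_add,
    intervalIntegral.integral_const_mul] at hgronwall
  calc ‖fundSol T A t - fundSol T B t‖
      ≤ x * (∫ s in t..T, ‖A s - B s‖) * Real.exp (∫ s in t..T, ‖A s‖) := hgronwall
    _ ≤ x * (∫ s in t..T, ‖A s - B s‖) * Real.exp L := by
        gcongr ?_ * ?_
        exact exp_integral_norm_le hT hA hAL ht
    _ = ‖(1 : Matrix p p ℝ)‖ * Real.exp L ^ 2 * ∫ s in t..T, ‖A s - B s‖ := by rw [hx]; ring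

lemma norm_fundSol_inv_le (hL : ∫ s in 0..T, ‖A s‖ ≤ L) (ht : t ∈ Icc 0 T) :
    ‖(fundSol T A t)⁻¹‖ ≤ ‖(1 : Matrix p p ℝ)‖ * Real.exp L := by
  rw [fundSol_inv hT hA ht, Matrix.frobenius_norm_transpose]
  exact norm_fundSol_le hT (integrable_neg_transpose hA)
    (by simpa only [norm_neg_transpose] using hL) ht

lemma norm_fundSol_inv_sub_le (hB : IntegrableOn B (Icc 0 T)) (hAL : ∫ s in 0..T, ‖A s‖ ≤ L)
    (hBL : ∫ s in 0..T, ‖B s‖ ≤ L) (ht : t ∈ Icc 0 T) :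
    ‖(fundSol T A t)⁻¹ - (fundSol T B t)⁻¹‖
      ≤ ‖(1 : Matrix p p ℝ)‖ * Real.exp L ^ 2 * ∫ s in t..T, ‖A s - B s‖ := by
  rw [fundSol_inv hT hA ht, fundSol_inv hT hB ht, ← Matrix.transpose_sub,
    Matrix.frobenius_norm_transpose]
  simpa only [← neg_sub', ← Matrix.transpose_sub, norm_neg_transpose] using
    norm_fundSol_sub_le hT (integrable_neg_transpose hA)
      (integrable_neg_transpose hB) (L := L) (by simpa only [norm_neg_transpose] using hAL)
      (by simpa only [norm_neg_transpose] using hBL) ht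

end

/-- The state-transition matrix `Φ(s,t)` of `X' = A X` on `[0,T]`; see `isTransition_transition`. -/
def transition (T : ℝ) (A : ℝ → Matrix p p ℝ) (s t : ℝ) : Matrix p p ℝ :=
  fundSol T A s * (fundSol T A t)⁻¹

section

variable {s : ℝ} (hT : 0 ≤ T) (hA : IntegrableOn A (Icc 0 T))

include hT hA

lemma transition_self (ht : t ∈ Icc 0 T) : transition T A t t = 1 :=
  fundSol_mul_fundSol_inv hT hA ht

lemma transition_right (t : ℝ) : transition T A T t = (fundSol T A t)⁻¹ := by
  rw [transition, fundSol_right hT hA, Matrix.one_mul]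

lemma continuousOn_transition (t : ℝ) :
    ContinuousOn (fun s => transition T A s t) (Icc 0 T) :=
  continuousOn_matrix_mul (isPrimitive_fundSol hT hA).continuousOn continuousOn_const

lemma isPrimitive_transition (t : ℝ) :
    IsPrimitive 0 T (fun s => transition T A s t) (fun s => A s * transition T A s t) := by
  simpa only [transition, Matrix.mul_assoc] using
    (isPrimitive_fundSol hT hA).mul_const (fundSol T A t)⁻¹

lemma norm_transition_le (hL : ∫ s in 0..T, ‖A s‖ ≤ L) (hs : s ∈ Icc 0 T) (ht : t ∈ Icc 0 T) :
    ‖transition T A s t‖ ≤ (‖(1 : Matrix p p ℝ)‖ * Real.exp L) ^ 2 := by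
  rw [sq]
  exact (Matrix.frobenius_norm_mul _ _).trans (mul_le_mul (norm_fundSol_le hT hA hL hs)
    (norm_fundSol_inv_le hT hA hL ht) (norm_nonneg _) (by positivity))

lemma norm_transition_sub_le (hB : IntegrableOn B (Icc 0 T)) (hAL : ∫ s in 0..T, ‖A s‖ ≤ L)
    (hBL : ∫ s in 0..T, ‖B s‖ ≤ L) (ht : t ∈ Icc 0 T) (hs : s ∈ Icc t T) :
    ‖transition T A s t - transition T B s t‖
      ≤ 2 * ‖(1 : Matrix p p ℝ)‖ ^ 2 * Real.exp L ^ 3 * ∫ r in t..T, ‖A r - B r‖ := by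
  have hs' : s ∈ Icc 0 T := Icc_subset_Icc_left ht.1 hs
  have hXs := norm_fundSol_sub_le hT hA hB hAL hBL hs'
  have hXt := norm_fundSol_inv_sub_le hT hA hB hAL hBL ht
  have hAt := norm_fundSol_inv_le hT hA hAL ht
  have hBs := norm_fundSol_le hT hB hBL hs'
  have hmono : ∫ r in s..T, ‖A r - B r‖ ≤ ∫ r in t..T, ‖A r - B r‖ :=
    antitoneOn_integral_tail (hA.sub hB).norm (fun r => norm_nonneg _) ht hs' hs.1
  have hI0 : 0 ≤ ∫ r in t..T, ‖A r - B r‖ :=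
    intervalIntegral.integral_nonneg_of_forall ht.2 fun r => norm_nonneg _
  set e := ‖(1 : Matrix p p ℝ)‖
  set I := ∫ r in t..T, ‖A r - B r‖
  calc ‖transition T A s t - transition T B s t‖
      ≤ _ := norm_mul_sub_mul_le _ _ _ _
    _ ≤ (e * Real.exp L ^ 2 * I) * (e * Real.exp L)
        + (e * Real.exp L) * (e * Real.exp L ^ 2 * I) := by
        gcongr
        exact hXs.trans (by gcongr)
    _ = 2 * e ^ 2 * Real.exp L ^ 3 * I := by ring

end

end LinearSystem

lemma matInt_eq_integral {p q : ℕ} {a b : ℝ} {F : ℝ → Matrix (Fin p) (Fin q) ℝ}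
    (hF : IntervalIntegrable F volume a b) : matInt a b F = ∫ s in a..b, F s := by
  ext i j
  exact (entryCLM i j).intervalIntegral_comp_comm hF

section IsTransition

variable {n : ℕ} {T s t : ℝ} {A : ℝ → Matrix (Fin n) (Fin n) ℝ}
  {Φ : ℝ → ℝ → Matrix (Fin n) (Fin n) ℝ}

lemma isTransition_transition (hT : 0 ≤ T) (hA : IntegrableOn A (Icc 0 T)) :
    IsTransition T A (transition T A) := fun s hs => by
  have hΦ := isPrimitive_transition hT hA s
  refine ⟨hΦ.continuousOn, fun t ht => ?_⟩
  rw [matInt_eq_integral (intervalIntegrable_of_mem_Icc hΦ.integrable hs ht),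
    hΦ.eq_add s hs t ht, transition_self hT hA hs]

lemma IsTransition.isPrimitive (hA : IntegrableOn A (Icc 0 T)) (hΦ : IsTransition T A Φ)
    (ht : t ∈ Icc 0 T) :
    IsPrimitive 0 T (fun s => Φ s t) (fun s => A s * Φ s t) := by
  have hint := integrableOn_matrix_mul_continuousOn hA (hΦ t ht).1
  refine IsPrimitive.of_eq_add (x := 1) hint ht fun s hs => ?_
  rw [(hΦ t ht).2 s hs, matInt_eq_integral (intervalIntegrable_of_mem_Icc hint ht hs)]

lemma IsTransition.eq_transition (hA : IntegrableOn A (Icc 0 T)) (hΦ : IsTransition T A Φ)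
    (hs : s ∈ Icc 0 T) (ht : t ∈ Icc 0 T) : Φ s t = transition T A s t := by
  have hT : 0 ≤ T := ht.1.trans ht.2
  have hX := (isPrimitive_fundSol hT hA).mul_const (Φ T t)
  have hfactor : ∀ r ∈ Icc 0 T, Φ r t = fundSol T A r * Φ T t := fun r hr =>
    sub_eq_zero.1 <| ((hΦ.isPrimitive hA ht).sub hX).eq_zero_of_norm_le hA.norm
      (fun s => norm_nonneg (A s)) (fun r _ => by
        rw [Matrix.mul_assoc, ← Matrix.mul_sub]
        exact Matrix.frobenius_norm_mul _ _) (by simp [fundSol_right hT hA]) hr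
  have hΦtt : Φ t t = 1 := by
    rw [(hΦ t ht).2 t ht]
    ext i j
    simp [matInt]
  have hinv : fundSol T A t * Φ T t = 1 := by rw [← hfactor t ht, hΦtt]
  rw [hfactor s hs, transition, Matrix.inv_eq_right_inv hinv]

end IsTransition

/-! ### Integrals over a triangle and Leibniz's rule -/

section Triangle

variable {E : Type*} [NormedAddCommGroup E] {a b r s t : ℝ} {F f : ℝ → ℝ → E}

lemma integrable_indicator_triangle
    (hf : IntegrableOn (Function.uncurry f) (Icc a b ×ˢ Icc a b)) (ht : a ≤ t) :
    Integrable ({z : ℝ × ℝ | z.1 ≤ z.2}.indicator (Function.uncurry f))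
      ((volume.restrict (Ioc t b)).prod (volume.restrict (Ioc t b))) := by
  have hsub : Ioc t b ⊆ Icc a b := fun s hs => ⟨ht.trans hs.1.le, hs.2⟩
  rw [Measure.prod_restrict]
  exact (hf.mono_set (prod_mono hsub hsub)).indicator
    (measurableSet_le measurable_fst measurable_snd)

variable [NormedSpace ℝ E]

lemma integral_indicator_triangle_fst (t : ℝ) (hs : s ∈ Ioc t b) :
    ∫ r in Ioc t b, {z : ℝ × ℝ | z.1 ≤ z.2}.indicator (Function.uncurry f) (r, s)
      = ∫ r in t..s, f r s := by
  have hind : (fun r => {z : ℝ × ℝ | z.1 ≤ z.2}.indicator (Function.uncurry f) (r, s))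
      = (Iic s).indicator (fun r => f r s) := by
    ext r
    by_cases hr : r ≤ s <;> simp [indicator, hr]
  rw [hind, setIntegral_indicator measurableSet_Iic, intervalIntegral.integral_of_le hs.1.le,
    Ioc_inter_Iic, min_eq_right hs.2]

lemma integral_indicator_triangle_snd (t : ℝ) (hr : r ∈ Ioc t b) :
    ∫ s in Ioc t b, {z : ℝ × ℝ | z.1 ≤ z.2}.indicator (Function.uncurry f) (r, s)
      = ∫ s in r..b, f r s := by
  have hind : (fun s => {z : ℝ × ℝ | z.1 ≤ z.2}.indicator (Function.uncurry f) (r, s))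
      = (Ici r).indicator (fun s => f r s) := by
    ext s
    by_cases hs : r ≤ s <;> simp [indicator, hs]
  have hset : Ioc t b ∩ Ici r = Icc r b := by
    ext s
    exact ⟨fun h => ⟨h.2, h.1.2⟩, fun h => ⟨⟨hr.1.trans_le h.1, h.2⟩, h.1⟩⟩
  rw [hind, setIntegral_indicator measurableSet_Ici, hset, intervalIntegral.integral_of_le hr.2,
    integral_Icc_eq_integral_Ioc]

section

variable (hf : IntegrableOn (Function.uncurry f) (Icc a b ×ˢ Icc a b))

include hf

lemma integral_triangle_swap (ht : t ∈ Icc a b) :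
    ∫ s in t..b, ∫ r in t..s, f r s = ∫ r in t..b, ∫ s in r..b, f r s := by
  rw [intervalIntegral.integral_of_le ht.2, intervalIntegral.integral_of_le ht.2,
    setIntegral_congr_fun measurableSet_Ioc fun s hs => (integral_indicator_triangle_fst t hs).symm,
    setIntegral_congr_fun measurableSet_Ioc fun r hr => (integral_indicator_triangle_snd t hr).symm]
  exact (integral_integral_swap
    (f := fun r s => {z : ℝ × ℝ | z.1 ≤ z.2}.indicator (Function.uncurry f) (r, s))
    (integrable_indicator_triangle hf ht.1)).symm

lemma intervalIntegrable_integral_triangle_fst (ht : t ∈ Icc a b) :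
    IntervalIntegrable (fun s => ∫ r in t..s, f r s) volume t b := by
  rw [intervalIntegrable_iff_integrableOn_Ioc_of_le ht.2]
  exact IntegrableOn.congr_fun (integrable_indicator_triangle hf ht.1).integral_prod_right
    (fun s hs => integral_indicator_triangle_fst t hs) measurableSet_Ioc

lemma integrableOn_integral_triangle_snd :
    IntegrableOn (fun r => ∫ s in r..b, f r s) (Icc a b) := by
  rw [integrableOn_Icc_iff_integrableOn_Ioc]
  exact IntegrableOn.congr_fun (integrable_indicator_triangle hf le_rfl).integral_prod_left
    (fun s hs => integral_indicator_triangle_snd a hs) measurableSet_Ioc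

lemma IsPrimitive.integral_tail (hab : a ≤ b) (hdiag : IntegrableOn (fun s => F s s) (Icc a b))
    (hF : ∀ s ∈ Icc a b, IsPrimitive a b (fun t => F t s) (fun t => f t s)) :
    IsPrimitive a b (fun t => ∫ s in t..b, F t s) (fun t => (∫ s in t..b, f t s) - F t t) := by
  have hsnd := integrableOn_integral_triangle_snd hf
  refine .of_eq_sub_tail (x := 0) (hsnd.sub hdiag) hab fun t ht => ?_
  have hdiag_t := intervalIntegrable_tail hdiag ht
  calc ∫ s in t..b, F t s = ∫ s in t..b, (F s s - ∫ r in t..s, f r s) := by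
        refine intervalIntegral.integral_congr fun s hs => ?_
        rw [uIcc_of_le ht.2] at hs
        have hs' : s ∈ Icc a b := Icc_subset_Icc_left ht.1 hs
        exact eq_sub_of_add_eq ((hF s hs').eq_add t ht s hs').symm
    _ = (∫ s in t..b, F s s) - ∫ r in t..b, ∫ s in r..b, f r s := by
        rw [intervalIntegral.integral_sub hdiag_t
          (intervalIntegrable_integral_triangle_fst hf ht), integral_triangle_swap hf ht]
    _ = 0 - ∫ r in t..b, ((∫ s in r..b, f r s) - F r r) := by
        rw [intervalIntegral.integral_sub (intervalIntegrable_tail hsnd ht) hdiag_t]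
        abel

end

end Triangle

/-! ### Quadratic costs along a linear system -/

lemma transpose_eq_of_posSemidef {p : Type*} {N : Matrix p p ℝ} (hN : N.PosSemidef) :
    Nᵀ = N := by
  simpa only [Matrix.conjTranspose_eq_transpose_of_trivial] using hN.isHermitian.eq

section Congruence

variable {p q : Type*} [Fintype p] [Fintype q]

lemma posSemidef_transpose_mul_mul {r : Type*} [Finite r] {N : Matrix q q ℝ}
    (hN : N.PosSemidef) (Z : Matrix q r ℝ) : (Zᵀ * N * Z).PosSemidef := by
  simpa only [Matrix.conjTranspose_eq_transpose_of_trivial] using hN.conjTranspose_mul_mul_same Z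

lemma posSemidef_integral {F : ℝ → Matrix p p ℝ} {a b : ℝ} (hab : a ≤ b)
    (h : ∀ s ∈ Icc a b, (F s).PosSemidef) : (∫ s in a..b, F s).PosSemidef := by
  by_cases hF : IntervalIntegrable F volume a b
  · refine Matrix.posSemidef_iff_dotProduct_mulVec.2 ⟨?_, fun x => ?_⟩
    · rw [Matrix.IsHermitian, Matrix.conjTranspose_eq_transpose_of_trivial, ← transposeCLM_apply,
        ← transposeCLM.intervalIntegral_comp_comm hF]
      refine intervalIntegral.integral_congr fun s hs => ?_
      rw [uIcc_of_le hab] at hs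
      exact transpose_eq_of_posSemidef (h s hs)
    · let quadForm : Matrix p p ℝ →L[ℝ] ℝ := LinearMap.toContinuousLinearMap
        { toFun := fun N => star x ⬝ᵥ N *ᵥ x
          map_add' := fun N N' => by rw [Matrix.add_mulVec, dotProduct_add]
          map_smul' := fun c N => by rw [Matrix.smul_mulVec, dotProduct_smul, RingHom.id_apply] }
      change 0 ≤ quadForm (∫ s in a..b, F s)
      rw [← quadForm.intervalIntegral_comp_comm hF]
      exact intervalIntegral.integral_nonneg hab fun s hs => (h s hs).dotProduct_mulVec_nonneg x
  · rw [intervalIntegral.integral_undef hF]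
    exact Matrix.PosSemidef.zero

lemma norm_transpose_mul_mul_sub_le (N : Matrix q q ℝ) (Z W : Matrix q p ℝ) :
    ‖Zᵀ * N * Z - Wᵀ * N * W‖ ≤ (‖Z‖ + ‖W‖) * ‖N‖ * ‖Z - W‖ := by
  have hZW : ‖Zᵀ * N - Wᵀ * N‖ ≤ ‖Z - W‖ * ‖N‖ := by
    rw [← Matrix.sub_mul, ← Matrix.transpose_sub, ← Matrix.frobenius_norm_transpose (Z - W)]
    exact Matrix.frobenius_norm_mul _ _
  have hW : ‖Wᵀ * N‖ ≤ ‖W‖ * ‖N‖ := by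
    rw [← Matrix.frobenius_norm_transpose W]
    exact Matrix.frobenius_norm_mul _ _
  calc ‖Zᵀ * N * Z - Wᵀ * N * W‖
      ≤ ‖Zᵀ * N - Wᵀ * N‖ * ‖Z‖ + ‖Wᵀ * N‖ * ‖Z - W‖ := norm_mul_sub_mul_le _ _ _ _
    _ ≤ ‖Z - W‖ * ‖N‖ * ‖Z‖ + ‖W‖ * ‖N‖ * ‖Z - W‖ := by gcongr
    _ = (‖Z‖ + ‖W‖) * ‖N‖ * ‖Z - W‖ := by ring

end Congruence

section Kernel

variable {E : Type*} [TopologicalSpace E] {T s t : ℝ} {K : ℝ → ℝ → E}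
  (hK : ContinuousOn (Function.uncurry K) (Icc 0 T ×ˢ Icc 0 T))

include hK

lemma continuousOn_left (ht : t ∈ Icc 0 T) : ContinuousOn (fun s => K t s) (Icc 0 T) :=
  hK.comp (f := fun s => (t, s)) (by fun_prop) fun _ hs => ⟨ht, hs⟩

lemma continuousOn_diag : ContinuousOn (fun t => K t t) (Icc 0 T) :=
  hK.comp (f := fun t => (t, t)) (by fun_prop) fun _ ht => ⟨ht, ht⟩

end Kernel

/-- `K` is continuous on `[0,T]²` and has there the continuous partial derivative `Kt` in its first
variable. -/
structure IsC1Kernel {E : Type*} [NormedAddCommGroup E] [NormedSpace ℝ E] (T : ℝ)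
    (K Kt : ℝ → ℝ → E) : Prop where
  continuousOn : ContinuousOn (Function.uncurry K) (Icc 0 T ×ˢ Icc 0 T)
  continuousOn_deriv : ContinuousOn (Function.uncurry Kt) (Icc 0 T ×ˢ Icc 0 T)
  isPrimitive : ∀ s ∈ Icc 0 T, IsPrimitive 0 T (fun t => K t s) (fun t => Kt t s)

section Cost

variable {p ι : Type*} [Fintype p] [Fintype ι] {T t : ℝ} {K Kt : ℝ → ℝ → Matrix ι ι ℝ}
  {Z : ℝ → Matrix ι p ℝ}

lemma integrableOn_transpose_mul_mul {k : ℝ → Matrix ι ι ℝ}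
    (hZ : MemLp Z ⊤ (volume.restrict (Icc 0 T))) (hk : ContinuousOn k (Icc 0 T)) :
    IntegrableOn (fun s => (Z s)ᵀ * k s * Z s) (Icc 0 T) :=
  (memLp_top_matrix_mul (memLp_top_matrix_mul (memLp_matrix_transpose hZ)
    (memLp_top_of_continuousOn isCompact_Icc hk)) hZ).integrable le_top

lemma IsC1Kernel.isPrimitive_integral_tail (hT : 0 ≤ T) (hK : IsC1Kernel T K Kt)
    (hZ : MemLp Z ⊤ (volume.restrict (Icc 0 T))) :
    IsPrimitive 0 T (fun t => ∫ s in t..T, (Z s)ᵀ * K t s * Z s)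
      (fun t => (∫ s in t..T, (Z s)ᵀ * Kt t s * Z s) - (Z t)ᵀ * K t t * Z t) := by
  refine IsPrimitive.integral_tail (F := fun t s => (Z s)ᵀ * K t s * Z s) ?_ hT
    (integrableOn_transpose_mul_mul hZ (continuousOn_diag hK.continuousOn))
    fun s hs => (hK.isPrimitive s hs).clm_comp (mulLeftRightCLM (Z s)ᵀ (Z s))
  have hZ₂ : MemLp (fun z : ℝ × ℝ => Z z.2) ⊤
      ((volume.restrict (Icc 0 T)).prod (volume.restrict (Icc 0 T))) := hZ.comp_snd _
  rw [Measure.prod_restrict] at hZ₂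
  have hKt : MemLp (Function.uncurry Kt) ⊤
      ((volume.prod volume).restrict (Icc 0 T ×ˢ Icc 0 T)) :=
    memLp_top_of_continuousOn (isCompact_Icc.prod isCompact_Icc) hK.continuousOn_deriv
  have : IsFiniteMeasure
      (((volume : Measure ℝ).prod volume).restrict (Icc 0 T ×ˢ Icc 0 T)) := by
    rw [← Measure.prod_restrict]
    infer_instance
  exact (memLp_top_matrix_mul (memLp_top_matrix_mul (memLp_matrix_transpose hZ₂) hKt)
    hZ₂).integrable le_top

variable [DecidableEq p] {A : ℝ → Matrix p p ℝ} {V : ℝ → Matrix ι p ℝ} {G Gt : ℝ → Matrix p p ℝ}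

/-- The matrix of the quadratic cost from time `t` on, with terminal weight `G t` and running
kernel `K t`, of the solutions of `X' = A X` with output `V X`. -/
def cost (T : ℝ) (A : ℝ → Matrix p p ℝ) (V : ℝ → Matrix ι p ℝ) (G : ℝ → Matrix p p ℝ)
    (K : ℝ → ℝ → Matrix ι ι ℝ) (t : ℝ) : Matrix p p ℝ :=
  (transition T A T t)ᵀ * G t * transition T A T t
    + ∫ s in t..T, (V s * transition T A s t)ᵀ * K t s * (V s * transition T A s t)

lemma posSemidef_cost (ht : t ≤ T) (hG : (G t).PosSemidef)
    (hK : ∀ s ∈ Icc t T, (K t s).PosSemidef) : (cost T A V G K t).PosSemidef :=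
  (posSemidef_transpose_mul_mul hG _).add
    (posSemidef_integral ht fun s hs => posSemidef_transpose_mul_mul (hK s hs) _)

section

variable (hT : 0 ≤ T) (hA : IntegrableOn A (Icc 0 T))

include hT hA

lemma cost_right : cost T A V G K T = G T := by
  simp [cost, transition_self hT hA (right_mem_Icc.2 hT)]

lemma transpose_inv_mul_output_mul_inv (N : Matrix ι ι ℝ) (ht : t ∈ Icc 0 T) :
    ((fundSol T A t)⁻¹)ᵀ * ((V t * fundSol T A t)ᵀ * N * (V t * fundSol T A t))
      * (fundSol T A t)⁻¹ = (V t)ᵀ * N * V t := by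
  have hXX := fundSol_mul_fundSol_inv hT hA ht
  calc ((fundSol T A t)⁻¹)ᵀ * ((V t * fundSol T A t)ᵀ * N * (V t * fundSol T A t))
        * (fundSol T A t)⁻¹
      = (V t * (fundSol T A t * (fundSol T A t)⁻¹))ᵀ * N
        * (V t * (fundSol T A t * (fundSol T A t)⁻¹)) := by
        simp only [Matrix.transpose_mul, Matrix.mul_assoc]
    _ = (V t)ᵀ * N * V t := by rw [hXX, Matrix.mul_one]

variable (hV : MemLp V ⊤ (volume.restrict (Icc 0 T)))

include hV

lemma memLp_mul_fundSol :
    MemLp (fun s => V s * fundSol T A s) ⊤ (volume.restrict (Icc 0 T)) :=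
  memLp_top_matrix_mul hV
    (memLp_top_of_continuousOn isCompact_Icc (isPrimitive_fundSol hT hA).continuousOn)

lemma memLp_mul_transition (t : ℝ) :
    MemLp (fun s => V s * transition T A s t) ⊤ (volume.restrict (Icc 0 T)) :=
  memLp_top_matrix_mul hV
    (memLp_top_of_continuousOn isCompact_Icc (continuousOn_transition hT hA t))

lemma cost_eq (hK : ContinuousOn (Function.uncurry K) (Icc 0 T ×ˢ Icc 0 T)) (ht : t ∈ Icc 0 T) :
    cost T A V G K t = ((fundSol T A t)⁻¹)ᵀ
      * (G t + ∫ s in t..T, (V s * fundSol T A s)ᵀ * K t s * (V s * fundSol T A s))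
      * (fundSol T A t)⁻¹ := by
  have hint := (mulLeftRightCLM ((fundSol T A t)⁻¹)ᵀ (fundSol T A t)⁻¹).intervalIntegral_comp_comm
    (intervalIntegrable_tail (integrableOn_transpose_mul_mul (memLp_mul_fundSol hT hA hV)
      (continuousOn_left hK ht)) ht)
  simp only [mulLeftRightCLM_apply] at hint
  rw [Matrix.mul_add, Matrix.add_mul, ← hint, cost, transition_right hT hA]
  simp only [transition, Matrix.transpose_mul, Matrix.mul_assoc]

/-- The Lyapunov equation of the cost; its inhomogeneity contains the cost of the time
derivatives of the weights. -/
lemma isPrimitive_cost (hG : IsPrimitive 0 T G Gt) (hK : IsC1Kernel T K Kt) :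
    IsPrimitive 0 T (cost T A V G K) (fun t =>
      -((A t)ᵀ * cost T A V G K t + cost T A V G K t * A t
        + ((V t)ᵀ * K t t * V t - cost T A V Gt Kt t))) := by
  have hXinv := isPrimitive_fundSol_inv hT hA
  have hinner := hG.add (hK.isPrimitive_integral_tail hT (memLp_mul_fundSol hT hA hV))
  refine ((hXinv.transpose.mul hinner).mul hXinv).congr
    (fun t ht => (cost_eq hT hA hV hK.continuousOn ht).symm) fun t ht => ?_
  rw [cost_eq hT hA hV hK.continuousOn ht, cost_eq hT hA hV hK.continuousOn_deriv ht,
    ← transpose_inv_mul_output_mul_inv hT hA (K t t) ht]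
  simp only [Matrix.transpose_neg, Matrix.transpose_mul]
  noncomm_ring

end

end Cost

section Lipschitz

lemma integral_tail_mono_ae {f g : ℝ → ℝ} {a b t : ℝ} (hf : IntegrableOn f (Icc a b))
    (hg : IntegrableOn g (Icc a b)) (ht : t ∈ Icc a b)
    (h : ∀ᵐ s ∂volume.restrict (Icc t b), f s ≤ g s) : ∫ s in t..b, f s ≤ ∫ s in t..b, g s :=
  intervalIntegral.integral_mono_ae_restrict ht.2 (intervalIntegrable_tail hf ht)
    (intervalIntegrable_tail hg ht) h

variable {p ι : Type*} [Fintype p] [Fintype ι] [DecidableEq p] {T L v s t : ℝ}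
  {A A' : ℝ → Matrix p p ℝ} {V V' : ℝ → Matrix ι p ℝ} {G : ℝ → Matrix p p ℝ}
  {K : ℝ → ℝ → Matrix ι ι ℝ}

/-- The system matrix `A` and the output matrix `V` are bounded by `L` in `L¹(0,T)` and by `v` in
`L^∞(0,T)`, respectively. -/
structure IsAdmissible (T L v : ℝ) (A : ℝ → Matrix p p ℝ) (V : ℝ → Matrix ι p ℝ) : Prop where
  integrableOn : IntegrableOn A (Icc 0 T)
  integral_norm_le : ∫ s in 0..T, ‖A s‖ ≤ L
  memLp : MemLp V ⊤ (volume.restrict (Icc 0 T))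
  ae_norm_le : ∀ᵐ s ∂volume.restrict (Icc 0 T), ‖V s‖ ≤ v

lemma IsAdmissible.integrableOn_norm_sub_add (h : IsAdmissible T L v A V)
    (h' : IsAdmissible T L v A' V') :
    IntegrableOn (fun s => ‖A s - A' s‖ + ‖V s - V' s‖) (Icc 0 T) :=
  (h.integrableOn.sub h'.integrableOn).norm.add ((h.memLp.sub h'.memLp).integrable le_top).norm

lemma IsAdmissible.integral_norm_sub_le (h : IsAdmissible T L v A V)
    (h' : IsAdmissible T L v A' V') (ht : t ∈ Icc 0 T) :
    ∫ s in t..T, ‖A s - A' s‖ ≤ ∫ s in t..T, (‖A s - A' s‖ + ‖V s - V' s‖) :=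
  integral_tail_mono_ae (h.integrableOn.sub h'.integrableOn).norm
    (h.integrableOn_norm_sub_add h') ht
    (ae_of_all _ fun _ => le_add_of_nonneg_right (norm_nonneg _))

section

variable (hT : 0 ≤ T)

include hT

lemma norm_mul_transition_le (hA : IntegrableOn A (Icc 0 T)) (hL : ∫ s in 0..T, ‖A s‖ ≤ L)
    (hv : 0 ≤ v) (hs : s ∈ Icc 0 T) (ht : t ∈ Icc 0 T) {W : Matrix ι p ℝ} (hW : ‖W‖ ≤ v) :
    ‖W * transition T A s t‖ ≤ v * (‖(1 : Matrix p p ℝ)‖ * Real.exp L) ^ 2 :=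
  (Matrix.frobenius_norm_mul _ _).trans
    (mul_le_mul hW (norm_transition_le hT hA hL hs ht) (norm_nonneg _) hv)

lemma exists_terminalCost_lipschitz (hG : ContinuousOn G (Icc 0 T)) (L : ℝ) :
    ∃ C, 0 ≤ C ∧ ∀ A A' : ℝ → Matrix p p ℝ, IntegrableOn A (Icc 0 T) → IntegrableOn A' (Icc 0 T) →
      ∫ s in 0..T, ‖A s‖ ≤ L → ∫ s in 0..T, ‖A' s‖ ≤ L → ∀ t ∈ Icc 0 T,
      ‖(transition T A T t)ᵀ * G t * transition T A T t
          - (transition T A' T t)ᵀ * G t * transition T A' T t‖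
        ≤ C * ∫ s in t..T, ‖A s - A' s‖ := by
  obtain ⟨g, hg⟩ := isCompact_Icc.exists_bound_of_continuousOn hG
  have hg0 : 0 ≤ g := (norm_nonneg _).trans (hg 0 (left_mem_Icc.2 hT))
  set y := (‖(1 : Matrix p p ℝ)‖ * Real.exp L) ^ 2
  set d := 2 * ‖(1 : Matrix p p ℝ)‖ ^ 2 * Real.exp L ^ 3
  refine ⟨(y + y) * g * d, by positivity, fun A A' hA hA' hL hL' t ht => ?_⟩
  have hTm : T ∈ Icc 0 T := right_mem_Icc.2 hT
  calc _ ≤ (‖transition T A T t‖ + ‖transition T A' T t‖) * ‖G t‖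
          * ‖transition T A T t - transition T A' T t‖ := norm_transpose_mul_mul_sub_le _ _ _
    _ ≤ (y + y) * g * (d * ∫ s in t..T, ‖A s - A' s‖) := by
        gcongr
        · exact norm_transition_le hT hA hL hTm ht
        · exact norm_transition_le hT hA' hL' hTm ht
        · exact hg t ht
        · exact norm_transition_sub_le hT hA hA' hL hL' ht ⟨ht.2, le_rfl⟩
    _ = (y + y) * g * d * ∫ s in t..T, ‖A s - A' s‖ := by ring

lemma norm_mul_transition_sub_le (h : IsAdmissible T L v A V) (h' : IsAdmissible T L v A' V')
    (hv : 0 ≤ v) (ht : t ∈ Icc 0 T) (hs : s ∈ Icc t T) (hV' : ‖V' s‖ ≤ v) :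
    ‖V s * transition T A s t - V' s * transition T A' s t‖
      ≤ (‖(1 : Matrix p p ℝ)‖ * Real.exp L) ^ 2 * (‖A s - A' s‖ + ‖V s - V' s‖)
        + v * (2 * ‖(1 : Matrix p p ℝ)‖ ^ 2 * Real.exp L ^ 3)
          * ∫ r in t..T, (‖A r - A' r‖ + ‖V r - V' r‖) := by
  have hs' : s ∈ Icc 0 T := ⟨ht.1.trans hs.1, hs.2⟩
  calc _ ≤ ‖V s - V' s‖ * ‖transition T A s t‖
          + ‖V' s‖ * ‖transition T A s t - transition T A' s t‖ := norm_mul_sub_mul_le _ _ _ _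
    _ ≤ (‖A s - A' s‖ + ‖V s - V' s‖) * (‖(1 : Matrix p p ℝ)‖ * Real.exp L) ^ 2
          + v * (2 * ‖(1 : Matrix p p ℝ)‖ ^ 2 * Real.exp L ^ 3
            * ∫ r in t..T, (‖A r - A' r‖ + ‖V r - V' r‖)) := by
        gcongr
        · exact le_add_of_nonneg_left (norm_nonneg _)
        · exact norm_transition_le hT h.integrableOn h.integral_norm_le hs' ht
        · refine (norm_transition_sub_le hT h.integrableOn h'.integrableOn h.integral_norm_le
            h'.integral_norm_le ht hs).trans ?_
          gcongr
          exact h.integral_norm_sub_le h' ht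
    _ = _ := by ring

lemma exists_ae_norm_runningCost_sub_le
    (hK : ContinuousOn (Function.uncurry K) (Icc 0 T ×ˢ Icc 0 T)) (L : ℝ) (hv : 0 ≤ v) :
    ∃ C, 0 ≤ C ∧ ∀ (A A' : ℝ → Matrix p p ℝ) (V V' : ℝ → Matrix ι p ℝ),
      IsAdmissible T L v A V → IsAdmissible T L v A' V' → ∀ t ∈ Icc 0 T,
      ∀ᵐ s ∂volume.restrict (Icc t T),
        ‖(V s * transition T A s t)ᵀ * K t s * (V s * transition T A s t)
            - (V' s * transition T A' s t)ᵀ * K t s * (V' s * transition T A' s t)‖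
          ≤ C * ((‖A s - A' s‖ + ‖V s - V' s‖)
            + ∫ r in t..T, (‖A r - A' r‖ + ‖V r - V' r‖)) := by
  obtain ⟨κ, hκ⟩ := (isCompact_Icc.prod isCompact_Icc).exists_bound_of_continuousOn hK
  have h0 : (0 : ℝ) ∈ Icc 0 T := left_mem_Icc.2 hT
  have hκ0 : 0 ≤ κ := (norm_nonneg _).trans (hκ (0, 0) ⟨h0, h0⟩)
  set y := (‖(1 : Matrix p p ℝ)‖ * Real.exp L) ^ 2
  set d := 2 * ‖(1 : Matrix p p ℝ)‖ ^ 2 * Real.exp L ^ 3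
  refine ⟨(v * y + v * y) * κ * (y + v * d), by positivity, fun A A' V V' h h' t ht => ?_⟩
  set D := ∫ r in t..T, (‖A r - A' r‖ + ‖V r - V' r‖)
  have hD : 0 ≤ D := intervalIntegral.integral_nonneg_of_forall ht.2 fun r => by positivity
  have hsub : Icc t T ⊆ Icc 0 T := Icc_subset_Icc_left ht.1
  filter_upwards [ae_restrict_of_ae_restrict_of_subset hsub h.ae_norm_le,
    ae_restrict_of_ae_restrict_of_subset hsub h'.ae_norm_le,
    ae_restrict_mem measurableSet_Icc] with s hV hV' hs
  have hZ := norm_mul_transition_le hT h.integrableOn h.integral_norm_le hv (hsub hs) ht hV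
  have hZ' := norm_mul_transition_le hT h'.integrableOn h'.integral_norm_le hv (hsub hs) ht hV'
  set δ := ‖A s - A' s‖ + ‖V s - V' s‖
  have : 0 ≤ δ := by positivity
  calc _ ≤ (‖V s * transition T A s t‖ + ‖V' s * transition T A' s t‖) * ‖K t s‖
          * ‖V s * transition T A s t - V' s * transition T A' s t‖ :=
        norm_transpose_mul_mul_sub_le _ _ _
    _ ≤ (v * y + v * y) * κ * (y * δ + v * d * D) := by
        gcongr ?_ * ?_ * ?_
        · exact add_le_add hZ hZ'
        · exact hκ (t, s) ⟨ht, hsub hs⟩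
        · exact norm_mul_transition_sub_le hT h h' hv ht hs hV'
    _ ≤ (v * y + v * y) * κ * ((y + v * d) * (δ + D)) := by
        gcongr
        have hcross : 0 ≤ y * D + v * d * δ := by positivity
        linarith
    _ = (v * y + v * y) * κ * (y + v * d) * (δ + D) := by ring

lemma exists_runningCost_lipschitz (hK : ContinuousOn (Function.uncurry K) (Icc 0 T ×ˢ Icc 0 T))
    (L : ℝ) (hv : 0 ≤ v) :
    ∃ C, 0 ≤ C ∧ ∀ (A A' : ℝ → Matrix p p ℝ) (V V' : ℝ → Matrix ι p ℝ),
      IsAdmissible T L v A V → IsAdmissible T L v A' V' → ∀ t ∈ Icc 0 T,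
      ‖(∫ s in t..T, (V s * transition T A s t)ᵀ * K t s * (V s * transition T A s t))
          - ∫ s in t..T, (V' s * transition T A' s t)ᵀ * K t s * (V' s * transition T A' s t)‖
        ≤ C * ∫ s in t..T, (‖A s - A' s‖ + ‖V s - V' s‖) := by
  obtain ⟨C, hC, hbound⟩ := exists_ae_norm_runningCost_sub_le (p := p) hT hK L hv
  refine ⟨C * (1 + T), by positivity, fun A A' V V' h h' t ht => ?_⟩
  set δ : ℝ → ℝ := fun s => ‖A s - A' s‖ + ‖V s - V' s‖
  set D := ∫ s in t..T, δ s
  have hD : 0 ≤ D := intervalIntegral.integral_nonneg_of_forall ht.2 fun s => by positivity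
  have hδ : IntervalIntegrable δ volume t T :=
    intervalIntegrable_tail (h.integrableOn_norm_sub_add h') ht
  rw [← intervalIntegral.integral_sub
    (intervalIntegrable_tail (integrableOn_transpose_mul_mul
      (memLp_mul_transition hT h.integrableOn h.memLp t) (continuousOn_left hK ht)) ht)
    (intervalIntegrable_tail (integrableOn_transpose_mul_mul
      (memLp_mul_transition hT h'.integrableOn h'.memLp t) (continuousOn_left hK ht)) ht)]
  calc _ ≤ ∫ s in t..T, C * (δ s + D) :=
        intervalIntegral.norm_integral_le_of_norm_le ht.2
          ((ae_restrict_iff' measurableSet_Ioc).1 (ae_restrict_of_ae_restrict_of_subset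
            Ioc_subset_Icc_self (hbound A A' V V' h h' t ht)))
          ((hδ.add intervalIntegrable_const).const_mul C)
    _ = C * (D + (T - t) * D) := by
        rw [intervalIntegral.integral_const_mul, intervalIntegral.integral_add hδ
          intervalIntegrable_const, intervalIntegral.integral_const, smul_eq_mul]
    _ ≤ C * (D + T * D) := by
        gcongr
        exact sub_le_self T ht.1
    _ = C * (1 + T) * D := by ring

lemma exists_cost_lipschitz (hG : ContinuousOn G (Icc 0 T))
    (hK : ContinuousOn (Function.uncurry K) (Icc 0 T ×ˢ Icc 0 T)) (L : ℝ) (hv : 0 ≤ v) :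
    ∃ C, 0 ≤ C ∧ ∀ (A A' : ℝ → Matrix p p ℝ) (V V' : ℝ → Matrix ι p ℝ),
      IsAdmissible T L v A V → IsAdmissible T L v A' V' → ∀ t ∈ Icc 0 T,
      ‖cost T A V G K t - cost T A' V' G K t‖
        ≤ C * ∫ s in t..T, (‖A s - A' s‖ + ‖V s - V' s‖) := by
  obtain ⟨C₁, hC₁, hterminal⟩ := exists_terminalCost_lipschitz hT hG L
  obtain ⟨C₂, hC₂, hrunning⟩ := exists_runningCost_lipschitz (p := p) hT hK L hv
  refine ⟨C₁ + C₂, add_nonneg hC₁ hC₂, fun A A' V V' h h' t ht => ?_⟩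
  rw [cost, cost, add_sub_add_comm, add_mul]
  refine (norm_add_le _ _).trans (add_le_add ?_ (hrunning A A' V V' h h' t ht))
  exact (hterminal A A' h.integrableOn h'.integrableOn h.integral_norm_le h'.integral_norm_le t
    ht).trans (mul_le_mul_of_nonneg_left (h.integral_norm_sub_le h' ht) hC₁)

end

end Lipschitz

/-! ### Continuously differentiable coefficients -/

lemma isPrimitive_derivWithin {E : Type*} [NormedAddCommGroup E] [NormedSpace ℝ E]
    [CompleteSpace E] {a b : ℝ} {g : ℝ → E} (hab : a < b) (hg : ContDiffOn ℝ 1 g (Icc a b)) :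
    IsPrimitive a b g (derivWithin g (Icc a b)) := by
  have hint : IntegrableOn (derivWithin g (Icc a b)) (Icc a b) :=
    (hg.continuousOn_derivWithin (uniqueDiffOn_Icc hab) le_rfl).integrableOn_compact isCompact_Icc
  refine IsPrimitive.of_eq_sub_tail (x := g b) hint hab.le fun t ht => ?_
  rw [intervalIntegral.integral_eq_sub_of_hasDerivAt_of_le ht.2
    (hg.continuousOn.mono (Icc_subset_Icc_left ht.1)) (fun x hx => ?_)
    (intervalIntegrable_tail hint ht), sub_sub_cancel]
  have hx' : x ∈ Ioo a b := Ioo_subset_Ioo_left ht.1 hx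
  exact (hg.differentiableOn one_ne_zero x (Ioo_subset_Icc_self hx')).hasDerivWithinAt.hasDerivAt
    (Icc_mem_nhds hx'.1 hx'.2)

section Kernel

variable {p q : Type*} [Fintype p] [Fintype q] {T : ℝ}

lemma continuousOn_derivWithin_fst {E : Type*} [NormedAddCommGroup E] [NormedSpace ℝ E]
    {u v : Set ℝ} (hu : UniqueDiffOn ℝ u) (hv : UniqueDiffOn ℝ v) {f : ℝ → ℝ → E}
    (hf : ContDiffOn ℝ 1 (Function.uncurry f) (u ×ˢ v)) :
    ContinuousOn (Function.uncurry fun t s => derivWithin (fun r => f r s) u t) (u ×ˢ v) := by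
  have hfst : ContinuousOn
      (fun z => fderivWithin ℝ (Function.uncurry f) (u ×ˢ v) z ((1 : ℝ), (0 : ℝ))) (u ×ˢ v) :=
    (hf.continuousOn_fderivWithin (hu.prod hv) le_rfl).clm_apply continuousOn_const
  refine hfst.congr fun z hz => ?_
  have hline : HasDerivWithinAt (fun r : ℝ => (r, z.2)) ((1 : ℝ), (0 : ℝ)) u z.1 :=
    (hasDerivWithinAt_id _ _).prodMk (hasDerivWithinAt_const _ _ _)
  have hmaps : MapsTo (fun r => (r, z.2)) u (u ×ˢ v) := fun r hr => ⟨hr, hz.2⟩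
  exact ((hf.differentiableOn one_ne_zero z hz).hasFDerivWithinAt.comp_hasDerivWithinAt z.1 hline
    hmaps).derivWithin (hu z.1 hz.1)

lemma isC1Kernel_of_entries (hT : 0 < T) {K Kt : ℝ → ℝ → Matrix p q ℝ}
    (hK : ∀ i j, ContDiffOn ℝ 1 (Function.uncurry fun t s => K t s i j) (Icc 0 T ×ˢ Icc 0 T))
    (hKt : ∀ t s i j, Kt t s i j = derivWithin (fun r => K r s i j) (Icc 0 T) t) :
    IsC1Kernel T K Kt where
  continuousOn := continuousOn_matrix_iff.2 fun i j => (hK i j).continuousOn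
  continuousOn_deriv := continuousOn_matrix_iff.2 fun i j => by
    simpa only [Function.uncurry_def, hKt] using
      continuousOn_derivWithin_fst (uniqueDiffOn_Icc hT) (uniqueDiffOn_Icc hT) (hK i j)
  isPrimitive s hs := .of_entries fun i j => by
    simp only [hKt]
    exact isPrimitive_derivWithin hT
      ((hK i j).comp (f := fun r => (r, s)) (by fun_prop) fun _ hr => ⟨hr, hs⟩)

end Kernel

lemma IsC1.isPrimitive {T : ℝ} (hT : 0 < T) {p q : ℕ} {F : ℝ → Matrix (Fin p) (Fin q) ℝ}
    (hF : IsC1 T F) : IsPrimitive 0 T F (dot T F) :=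
  .of_entries fun i j => isPrimitive_derivWithin hT (hF i j)

lemma IsC1Sq.continuousOn {T : ℝ} {p q : ℕ} {F : ℝ → ℝ → Matrix (Fin p) (Fin q) ℝ}
    (hF : IsC1Sq T F) : ContinuousOn (Function.uncurry F) (Icc 0 T ×ˢ Icc 0 T) :=
  continuousOn_matrix_iff.2 fun i j => (hF i j).continuousOn

/-! ### Outputs of a feedback law -/

section Output

variable {n m : Type*} [Fintype n] [Fintype m]

lemma norm_sq_eq_sum_sq (F : Matrix n m ℝ) : ‖F‖ ^ 2 = ∑ i, ∑ j, F i j ^ 2 := by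
  rw [Matrix.frobenius_norm_def, ← Real.sqrt_eq_rpow, Real.sq_sqrt (by positivity)]
  simp only [Real.norm_eq_abs, Real.rpow_ofNat, sq_abs]

lemma norm_fromRows_sq {q : Type*} [Fintype q] (F : Matrix n q ℝ) (G : Matrix m q ℝ) :
    ‖Matrix.fromRows F G‖ ^ 2 = ‖F‖ ^ 2 + ‖G‖ ^ 2 := by
  simp only [norm_sq_eq_sum_sq, Fintype.sum_sum_type, Matrix.fromRows_apply_inl,
    Matrix.fromRows_apply_inr]

variable [DecidableEq n]

/-- The map from states to state-control pairs under the feedback `u = - U x`. -/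
def output (U : ℝ → Matrix m n ℝ) (s : ℝ) : Matrix (n ⊕ m) n ℝ :=
  Matrix.fromRows 1 (-(U s))

lemma norm_output_sub (U U' : ℝ → Matrix m n ℝ) (s : ℝ) :
    ‖output U s - output U' s‖ = ‖U s - U' s‖ := by
  have hsub : output U s - output U' s = Matrix.fromRows 0 (-(U s - U' s)) := by
    ext (i | i) j
    · simp only [output, Matrix.sub_apply, Matrix.fromRows_apply_inl, sub_self, Matrix.zero_apply]
    · simp only [output, Matrix.sub_apply, Matrix.neg_apply, Matrix.fromRows_apply_inr]
      ring
  refine (pow_left_inj₀ (norm_nonneg _) (norm_nonneg _) two_ne_zero).1 ?_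
  rw [hsub, norm_fromRows_sq, norm_zero, norm_neg, zero_pow two_ne_zero, zero_add]

lemma norm_output_le (U : ℝ → Matrix m n ℝ) (s : ℝ) :
    ‖output U s‖ ≤ ‖(1 : Matrix n n ℝ)‖ + ‖U s‖ := by
  refine (pow_le_pow_iff_left₀ (norm_nonneg _) (by positivity) two_ne_zero).1 ?_
  rw [output, norm_fromRows_sq, norm_neg, add_sq]
  have hcross : 0 ≤ 2 * ‖(1 : Matrix n n ℝ)‖ * ‖U s‖ := by positivity
  linarith

lemma memLp_output {T : ℝ} {U : ℝ → Matrix m n ℝ} (hU : MemLp U ⊤ (volume.restrict (Icc 0 T))) :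
    MemLp (output U) ⊤ (volume.restrict (Icc 0 T)) := by
  refine memLp_matrix_iff.2 ?_
  rintro (i | i) j
  · exact memLp_const _
  · exact (memLp_matrix_iff.1 hU i j).neg

lemma transpose_output_mul_fromBlocks_mul_output (U : ℝ → Matrix m n ℝ) (s : ℝ)
    (Q : Matrix n n ℝ) (S : Matrix m n ℝ) (M : Matrix m m ℝ) :
    (output U s)ᵀ * Matrix.fromBlocks Q Sᵀ S M * output U s
      = Q + ((U s)ᵀ * M * U s - (U s)ᵀ * S - Sᵀ * U s) := by
  rw [output, Matrix.transpose_fromRows, Matrix.fromCols_mul_fromBlocks,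
    Matrix.fromCols_mul_fromRows]
  simp only [Matrix.transpose_one, Matrix.one_mul, Matrix.mul_one, Matrix.transpose_neg,
    Matrix.neg_mul, Matrix.mul_neg, Matrix.add_mul]
  abel

end Output

/-! ### Lyapunov equations -/

section Lyapunov

variable {p : Type*} [Fintype p] {a b t : ℝ} {A D F F' : ℝ → Matrix p p ℝ}

lemma integrableOn_transpose_mul_add_mul (hA : IntegrableOn A (Icc a b))
    (hF : ContinuousOn F (Icc a b)) :
    IntegrableOn (fun s => (A s)ᵀ * F s + F s * A s) (Icc a b) := by
  have hA₁ := memLp_one_iff_integrable.2 hA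
  have hF_top := memLp_top_of_continuousOn (ν := volume) isCompact_Icc hF
  exact (memLp_one_iff_integrable.1
    (memLp_matrix_mul (R := 1) (memLp_matrix_transpose hA₁) hF_top)).add
      (memLp_one_iff_integrable.1 (memLp_matrix_mul (R := 1) hF_top hA₁))

lemma IsPrimitive.eq_of_lyapunov (hA : IntegrableOn A (Icc a b))
    (hF : IsPrimitive a b F fun s => -((A s)ᵀ * F s + F s * A s + D s))
    (hF' : IsPrimitive a b F' fun s => -((A s)ᵀ * F' s + F' s * A s + D s))
    (hb : F b = F' b) (ht : t ∈ Icc a b) : F t = F' t := by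
  refine sub_eq_zero.1 ((hF.sub hF').eq_zero_of_norm_le (hA.norm.const_mul 2)
    (fun s => by positivity) (fun s _ => ?_) (sub_eq_zero.2 hb) ht)
  calc ‖-((A s)ᵀ * F s + F s * A s + D s) - -((A s)ᵀ * F' s + F' s * A s + D s)‖
      = ‖(A s)ᵀ * (F s - F' s) + (F s - F' s) * A s‖ := by
        rw [← norm_neg]
        congr 1
        noncomm_ring
    _ ≤ ‖(A s)ᵀ‖ * ‖F s - F' s‖ + ‖F s - F' s‖ * ‖A s‖ :=
        norm_add_le_of_le (Matrix.frobenius_norm_mul _ _) (Matrix.frobenius_norm_mul _ _)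
    _ = 2 * ‖A s‖ * ‖F s - F' s‖ := by rw [Matrix.frobenius_norm_transpose]; ring

end Lyapunov

/-! ### The equilibrium Riccati equation as a fixed-point equation -/

lemma riccati_completion {n m : Type*} [Fintype n] [Fintype m] {A P Q : Matrix n n ℝ}
    {B : Matrix n m ℝ} {S U : Matrix m n ℝ} {M : Matrix m m ℝ} (hU : M * U = Bᵀ * P + S) :
    Aᵀ * P + P * A + Q - (P * B + Sᵀ) * U
      = (A - B * U)ᵀ * P + P * (A - B * U) + (Q + (Uᵀ * M * U - Uᵀ * S - Sᵀ * U)) := by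
  rw [Matrix.mul_assoc Uᵀ, hU, Matrix.transpose_sub, Matrix.transpose_mul]
  simp only [Matrix.mul_add, Matrix.add_mul, Matrix.mul_sub, Matrix.sub_mul, Matrix.mul_assoc]
  abel

lemma matInt_congr {p q : ℕ} {a b : ℝ} {F F' : ℝ → Matrix (Fin p) (Fin q) ℝ}
    (h : ∀ s ∈ uIcc a b, F s = F' s) : matInt a b F = matInt a b F' := by
  ext i j
  exact intervalIntegral.integral_congr fun s hs => by rw [h s hs]

namespace Coeffs

section Definitions

variable {n m : ℕ} (c : Coeffs n m)

/-- The block matrix of the running cost. -/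
def kernel (t s : ℝ) : Matrix (Fin n ⊕ Fin m) (Fin n ⊕ Fin m) ℝ :=
  Matrix.fromBlocks (c.Q t s) (c.S t s)ᵀ (c.S t s) (c.M t s)

/-- The partial derivative of the running cost in its first variable. -/
def kernelDeriv (T t s : ℝ) : Matrix (Fin n ⊕ Fin m) (Fin n ⊕ Fin m) ℝ :=
  Matrix.fromBlocks (dfst T c.Q t s) (dfst T c.S t s)ᵀ (dfst T c.S t s) (dfst T c.M t s)

/-- The cost-to-go matrix under the feedback determined by `P`. -/
def value (T : ℝ) (P : ℝ → Matrix (Fin n) (Fin n) ℝ) : ℝ → Matrix (Fin n) (Fin n) ℝ :=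
  cost T (c.closedLoop P) (output (c.Upsilon P)) c.G c.kernel

/-- The sensitivity of the cost-to-go with respect to the evaluation time `t` of the running and
terminal costs; it is the nonlocal part of `Qbar`. -/
def drift (T : ℝ) (P : ℝ → Matrix (Fin n) (Fin n) ℝ) : ℝ → Matrix (Fin n) (Fin n) ℝ :=
  cost T (c.closedLoop P) (output (c.Upsilon P)) (dot T c.G) (c.kernelDeriv T)

/-- The inhomogeneous term of the Lyapunov equation of the closed-loop system. -/
def source (T : ℝ) (P : ℝ → Matrix (Fin n) (Fin n) ℝ) (s : ℝ) : Matrix (Fin n) (Fin n) ℝ :=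
  (output (c.Upsilon P) s)ᵀ * c.kernel s s * output (c.Upsilon P) s - c.drift T P s

end Definitions

variable {n m : ℕ} {c : Coeffs n m} {T s t : ℝ}

lemma isC1Kernel_kernel (hT : 0 < T) (h2 : H2 T c) (h3 : H3 T c) (h4 : H4 T c) :
    IsC1Kernel T c.kernel (c.kernelDeriv T) := by
  refine isC1Kernel_of_entries hT ?_ ?_
  · rintro (i | i) (j | j)
    exacts [h3.Q_C1 i j, h4.S_C1 j i, h4.S_C1 i j, h2.M_C1 i j]
  · rintro t s (i | i) (j | j) <;> rfl

lemma posSemidef_kernel (h2 : H2 T c) (h5 : H5 T c) (h0 : 0 ≤ t) (hts : t ≤ s) (hs : s ≤ T) :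
    (c.kernel t s).PosSemidef := by
  have hM := h2.M_pos t ⟨h0, hts.trans hs⟩ s ⟨h0.trans hts, hs⟩
  have : Invertible (c.M t s) := hM.isUnit.invertible
  have hblock := (Matrix.PosDef.fromBlocks₂₂ (c.Q t s) (c.S t s)ᵀ hM).2
    (by simpa using h5.schur_nonneg t s h0 hts hs)
  simpa [kernel] using hblock

-- With `M_t L = S_t`, completing the square writes the block matrix as
-- `[1 0]ᵀ (Q_t - S_tᵀ L) [1 0] + [L 1]ᵀ M_t [L 1]`, without inverting `M_t`.
lemma posSemidef_kernelDeriv (h5 : H5 T c) (h0 : 0 ≤ t) (hts : t ≤ s) (hs : s ≤ T) :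
    (c.kernelDeriv T t s).PosSemidef := by
  obtain ⟨L, hL, hschur⟩ := h5.schur_t_nonneg t s h0 hts hs
  have hM := h5.Mt_nonneg t s h0 hts hs
  have hLM : Lᵀ * dfst T c.M t s = (dfst T c.S t s)ᵀ := by
    rw [← hL, Matrix.transpose_mul, transpose_eq_of_posSemidef hM]
  convert (posSemidef_transpose_mul_mul hschur
      (Matrix.fromCols (1 : Matrix (Fin n) (Fin n) ℝ) (0 : Matrix (Fin n) (Fin m) ℝ))).add
    (posSemidef_transpose_mul_mul hM (Matrix.fromCols L (1 : Matrix (Fin m) (Fin m) ℝ))) using 1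
  rw [Matrix.transpose_fromCols, Matrix.transpose_fromCols, Matrix.fromRows_mul,
    Matrix.fromRows_mul_fromCols, Matrix.fromRows_mul, Matrix.fromRows_mul_fromCols,
    Matrix.fromBlocks_add, hLM, kernelDeriv]
  simp [hL]

lemma posSemidef_value (h2 : H2 T c) (h3 : H3 T c) (h5 : H5 T c)
    (P : ℝ → Matrix (Fin n) (Fin n) ℝ) (ht : t ∈ Icc 0 T) : (c.value T P t).PosSemidef :=
  posSemidef_cost ht.2 (h3.G_nonneg t ht) fun _ hs => posSemidef_kernel h2 h5 ht.1 hs.1 hs.2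

lemma posSemidef_drift (h5 : H5 T c) (P : ℝ → Matrix (Fin n) (Fin n) ℝ) (ht : t ∈ Icc 0 T) :
    (c.drift T P t).PosSemidef :=
  posSemidef_cost ht.2 (h5.G_dot_nonneg t ht) fun _ hs => posSemidef_kernelDeriv h5 ht.1 hs.1 hs.2

lemma continuousOn_inv (h2 : H2 T c) : ContinuousOn (fun s => (c.M s s)⁻¹) (Icc 0 T) := by
  have hM := continuousOn_diag h2.M_C1.continuousOn
  have hdet : ContinuousOn (fun s => (c.M s s).det) (Icc 0 T) :=
    (Continuous.matrix_det continuous_id).comp_continuousOn hM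
  have hadj : ContinuousOn (fun s => (c.M s s).adjugate) (Icc 0 T) :=
    (Continuous.matrix_adjugate continuous_id).comp_continuousOn hM
  refine ((hdet.inv₀ fun s hs => (h2.M_pos s hs s hs).det_pos.ne').smul hadj).congr fun s _ => ?_
  rw [Matrix.inv_def, Ring.inverse_eq_inv']
  rfl

lemma integrableOn_A (h1 : H1 T c) : IntegrableOn c.A (Icc 0 T) :=
  memLp_one_iff_integrable.1 (memLp_matrix_iff.2 h1.A_mem)

lemma memLp_B (h1 : H1 T c) : MemLp c.B ⊤ (volume.restrict (Icc 0 T)) :=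
  memLp_matrix_iff.2 h1.B_mem

section ClosedLoop

variable {P : ℝ → Matrix (Fin n) (Fin n) ℝ} {Φ Ψ : ℝ → ℝ → Matrix (Fin n) (Fin n) ℝ}

lemma Qbar_congr (ht : t ≤ T) (h : ∀ s ∈ Icc t T, Φ s t = Ψ s t) :
    c.Qbar T P Φ t = c.Qbar T P Ψ t := by
  rw [← uIcc_of_le ht] at h
  rw [Qbar, Qbar, h T right_mem_uIcc,
    matInt_congr (F := fun s => (Φ s t)ᵀ * dfst T c.Q t s * Φ s t) fun s hs => by rw [h s hs],
    matInt_congr (F := fun s => (Φ s t)ᵀ * (_ - _ - _) * Φ s t) fun s hs => by rw [h s hs]]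

lemma M_mul_Upsilon (h2 : H2 T c) (hs : s ∈ Icc 0 T) :
    c.M s s * c.Upsilon P s = (c.B s)ᵀ * P s + c.S s s := by
  rw [Upsilon, ← Matrix.mul_assoc, Matrix.mul_nonsing_inv _ (h2.M_pos s hs s hs).det_pos.ne'.isUnit,
    Matrix.one_mul]

variable (hT : 0 < T) (h1 : H1 T c) (h2 : H2 T c) (h3 : H3 T c) (h4 : H4 T c)
  (hP : ContinuousOn P (Icc 0 T))

include h1 h2 h4 hP

lemma memLp_Upsilon : MemLp (c.Upsilon P) ⊤ (volume.restrict (Icc 0 T)) :=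
  memLp_top_matrix_mul (memLp_top_of_continuousOn isCompact_Icc (continuousOn_inv h2))
    ((memLp_top_matrix_mul (memLp_matrix_transpose (memLp_B h1))
      (memLp_top_of_continuousOn isCompact_Icc hP)).add
        (memLp_top_of_continuousOn isCompact_Icc (continuousOn_diag h4.S_C1.continuousOn)))

lemma integrableOn_closedLoop : IntegrableOn (c.closedLoop P) (Icc 0 T) :=
  (integrableOn_A h1).sub
    ((memLp_top_matrix_mul (memLp_B h1) (memLp_Upsilon h1 h2 h4 hP)).integrable le_top)

include hT h3

lemma isPrimitive_value : IsPrimitive 0 T (c.value T P) fun t =>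
    -((c.closedLoop P t)ᵀ * c.value T P t + c.value T P t * c.closedLoop P t + c.source T P t) :=
  isPrimitive_cost hT.le (integrableOn_closedLoop h1 h2 h4 hP)
    (memLp_output (memLp_Upsilon h1 h2 h4 hP)) (h3.G_C1.isPrimitive hT)
    (isC1Kernel_kernel hT h2 h3 h4)

lemma integrableOn_source : IntegrableOn (c.source T P) (Icc 0 T) := by
  have hv := isPrimitive_value hT h1 h2 h3 h4 hP
  refine (hv.integrable.neg.sub (integrableOn_transpose_mul_add_mul
    (integrableOn_closedLoop h1 h2 h4 hP) hv.continuousOn)).congr_fun (fun s _ => ?_)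
    measurableSet_Icc
  simp only [Pi.sub_apply, Pi.neg_apply, neg_neg, add_sub_cancel_left]

lemma matInt_add_matInt_eq_integral_kernelDeriv (ht : t ∈ Icc 0 T) :
    let Φ := transition T (c.closedLoop P)
    let U := c.Upsilon P
    matInt t T (fun s => (Φ s t)ᵀ * dfst T c.Q t s * Φ s t)
        + matInt t T (fun s => (Φ s t)ᵀ * ((U s)ᵀ * dfst T c.M t s * U s
          - (U s)ᵀ * dfst T c.S t s - (dfst T c.S t s)ᵀ * U s) * Φ s t)
      = ∫ s in t..T, (output U s * Φ s t)ᵀ * c.kernelDeriv T t s * (output U s * Φ s t) := by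
  intro Φ U
  have ha := integrableOn_closedLoop h1 h2 h4 hP
  have hKt := continuousOn_left (isC1Kernel_kernel hT h2 h3 h4).continuousOn_deriv ht
  have hQt : ContinuousOn (fun s => dfst T c.Q t s) (Icc 0 T) :=
    continuousOn_matrix_iff.2 fun i j => continuousOn_matrix_iff.1 hKt (Sum.inl i) (Sum.inl j)
  have hfull := intervalIntegrable_tail (integrableOn_transpose_mul_mul
    (memLp_mul_transition hT.le ha (memLp_output (memLp_Upsilon h1 h2 h4 hP)) t) hKt) ht
  have hstate := intervalIntegrable_tail (integrableOn_transpose_mul_mul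
    (memLp_top_of_continuousOn isCompact_Icc (continuousOn_transition hT.le ha t)) hQt) ht
  have hsplit : ∀ s, (Φ s t)ᵀ * ((U s)ᵀ * dfst T c.M t s * U s - (U s)ᵀ * dfst T c.S t s
        - (dfst T c.S t s)ᵀ * U s) * Φ s t
      = (output U s * Φ s t)ᵀ * c.kernelDeriv T t s * (output U s * Φ s t)
        - (Φ s t)ᵀ * dfst T c.Q t s * Φ s t := fun s => by
    rw [eq_sub_iff_add_eq', ← Matrix.add_mul, ← Matrix.mul_add,
      ← transpose_output_mul_fromBlocks_mul_output, ← kernelDeriv]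
    simp only [Matrix.transpose_mul, Matrix.mul_assoc]
  simp only [hsplit]
  rw [matInt_eq_integral hstate, matInt_eq_integral (hfull.sub hstate),
    intervalIntegral.integral_sub hfull hstate, add_sub_cancel]

lemma Qbar_eq (hΦ : IsTransition T (c.closedLoop P) Φ) (ht : t ∈ Icc 0 T) :
    c.Qbar T P Φ t = c.Q t t - c.drift T P t := by
  rw [Qbar_congr ht.2 fun s hs => hΦ.eq_transition (integrableOn_closedLoop h1 h2 h4 hP)
      ⟨ht.1.trans hs.1, hs.2⟩ ht, Qbar, sub_sub,
    matInt_add_matInt_eq_integral_kernelDeriv hT h1 h2 h3 h4 hP ht, sub_sub]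
  rfl

lemma riccati_integrand_eq (hΦ : IsTransition T (c.closedLoop P) Φ) (hs : s ∈ Icc 0 T) :
    (c.A s)ᵀ * P s + P s * c.A s + c.Qbar T P Φ s
        - (P s * c.B s + (c.S s s)ᵀ) * (c.M s s)⁻¹ * ((c.B s)ᵀ * P s + c.S s s)
      = (c.closedLoop P s)ᵀ * P s + P s * c.closedLoop P s + c.source T P s := by
  rw [Qbar_eq hT h1 h2 h3 h4 hP hΦ hs, Matrix.mul_assoc, ← Upsilon, add_sub, sub_right_comm,
    riccati_completion (M_mul_Upsilon h2 hs), source, kernel,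
    transpose_output_mul_fromBlocks_mul_output, closedLoop, add_sub_assoc]

lemma riccati_eqn_iff_isPrimitive (hΦ : IsTransition T (c.closedLoop P) Φ) :
    (∀ t ∈ Icc 0 T, P t = c.G T + matInt t T (fun s =>
        (c.A s)ᵀ * P s + P s * c.A s + c.Qbar T P Φ s
          - (P s * c.B s + (c.S s s)ᵀ) * (c.M s s)⁻¹ * ((c.B s)ᵀ * P s + c.S s s)))
      ↔ P T = c.G T ∧ IsPrimitive 0 T P fun s =>
        -((c.closedLoop P s)ᵀ * P s + P s * c.closedLoop P s + c.source T P s) := by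
  have hint : IntegrableOn (fun s =>
      (c.closedLoop P s)ᵀ * P s + P s * c.closedLoop P s + c.source T P s) (Icc 0 T) :=
    (integrableOn_transpose_mul_add_mul (integrableOn_closedLoop h1 h2 h4 hP) hP).add
      (integrableOn_source hT h1 h2 h3 h4 hP)
  have hmatInt : ∀ t ∈ Icc 0 T, matInt t T (fun s =>
      (c.A s)ᵀ * P s + P s * c.A s + c.Qbar T P Φ s
        - (P s * c.B s + (c.S s s)ᵀ) * (c.M s s)⁻¹ * ((c.B s)ᵀ * P s + c.S s s))
      = -∫ s in t..T, -((c.closedLoop P s)ᵀ * P s + P s * c.closedLoop P s + c.source T P s) := by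
    intro t ht
    rw [intervalIntegral.integral_neg, neg_neg,
      ← matInt_eq_integral (intervalIntegrable_tail hint ht)]
    refine matInt_congr fun s hs => riccati_integrand_eq hT h1 h2 h3 h4 hP hΦ ?_
    exact uIcc_subset_Icc ht (right_mem_Icc.2 hT.le) hs
  refine ⟨fun h => ?_, fun ⟨hPT, hprim⟩ t ht => ?_⟩
  · have htail := fun t ht => (h t ht).trans
      (by rw [hmatInt t ht, ← sub_eq_add_neg] : _ = c.G T - _)
    exact ⟨by simpa using htail T (right_mem_Icc.2 hT.le),
      .of_eq_sub_tail hint.neg hT.le htail⟩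
  · rw [hmatInt t ht, ← sub_eq_add_neg, ← hPT]
    exact hprim.eq_sub_tail ht

end ClosedLoop

lemma isRiccatiSolution_iff (hT : 0 < T) (h1 : H1 T c) (h2 : H2 T c) (h3 : H3 T c) (h4 : H4 T c)
    (h5 : H5 T c) {P : ℝ → Matrix (Fin n) (Fin n) ℝ} :
    IsRiccatiSolution T c P
      ↔ ContinuousOn P (Icc 0 T) ∧ ∀ t ∈ Icc 0 T, P t = c.value T P t := by
  have hvalue_right : ContinuousOn P (Icc 0 T) → c.value T P T = c.G T := fun hP =>
    cost_right hT.le (integrableOn_closedLoop h1 h2 h4 hP)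
  constructor
  · rintro ⟨hP, -, Φ, hΦ, heqn⟩
    obtain ⟨hPT, hprim⟩ := (riccati_eqn_iff_isPrimitive hT h1 h2 h3 h4 hP hΦ).1 heqn
    exact ⟨hP, fun t ht => hprim.eq_of_lyapunov (integrableOn_closedLoop h1 h2 h4 hP)
      (isPrimitive_value hT h1 h2 h3 h4 hP) (hPT.trans (hvalue_right hP).symm) ht⟩
  · rintro ⟨hP, hvalue⟩
    have hTm : T ∈ Icc 0 T := right_mem_Icc.2 hT.le
    have hΦ := isTransition_transition hT.le (integrableOn_closedLoop h1 h2 h4 hP)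
    refine ⟨hP, fun t ht => ?_, _, hΦ, (riccati_eqn_iff_isPrimitive hT h1 h2 h3 h4 hP hΦ).2
      ⟨(hvalue T hTm).trans (hvalue_right hP), ?_⟩⟩
    · rw [hvalue t ht]
      exact transpose_eq_of_posSemidef (posSemidef_value h2 h3 h5 P ht)
    · exact (isPrimitive_value hT h1 h2 h3 h4 hP).congr (fun t ht => (hvalue t ht).symm)
        fun t ht => by rw [hvalue t ht]

end Coeffs

/-! ### Trace estimates -/

section Trace

variable {n m : Type*} [Fintype n] [Fintype m]

lemma norm_le_trace {F : Matrix n n ℝ} (hF : F.PosSemidef) : ‖F‖ ≤ F.trace := by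
  obtain ⟨C, rfl⟩ := exists_eq_transpose_mul_self hF
  calc ‖Cᵀ * C‖ ≤ ‖Cᵀ‖ * ‖C‖ := Matrix.frobenius_norm_mul _ _
    _ = ∑ i, ∑ j, C i j ^ 2 := by
        rw [Matrix.frobenius_norm_transpose, ← sq, norm_sq_eq_sum_sq]
    _ = (Cᵀ * C).trace := by
        rw [Finset.sum_comm]
        simp only [Matrix.trace, Matrix.diag_apply, Matrix.mul_apply, Matrix.transpose_apply, sq]

-- The feedback `U` is built from `ρ P` instead of `P`; both quadratic terms have a favourable sign
-- for every `ρ ∈ [0, 1]`, and what is left is linear in `P` with coefficients independent of `ρ`.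
lemma scaled_riccati_completion {A P Q : Matrix n n ℝ} {B : Matrix n m ℝ} {S U : Matrix m n ℝ}
    {M N : Matrix m m ℝ} [DecidableEq m] (hP : Pᵀ = P) (hN : Nᵀ = N) (hMN : M * N = 1) {ρ : ℝ}
    (hU : U = N * (Bᵀ * (ρ • P) + S)) :
    (A - B * U)ᵀ * P + P * (A - B * U) + (Q + (Uᵀ * M * U - Uᵀ * S - Sᵀ * U))
      = (A - B * (N * S))ᵀ * P + P * (A - B * (N * S)) + Q
        - (ρ * (2 - ρ)) • ((Bᵀ * P)ᵀ * N * (Bᵀ * P)) - Sᵀ * N * S := by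
  have hMU : M * U = Bᵀ * (ρ • P) + S := by rw [hU, ← Matrix.mul_assoc, hMN, Matrix.one_mul]
  rw [Matrix.mul_assoc Uᵀ, hMU, hU]
  simp only [Matrix.transpose_add, Matrix.transpose_sub, Matrix.transpose_mul,
    Matrix.transpose_smul, Matrix.transpose_transpose, hP, hN, Matrix.mul_add, Matrix.add_mul,
    Matrix.mul_sub, Matrix.sub_mul, Matrix.mul_smul, Matrix.smul_mul, Matrix.mul_assoc]
  module

lemma trace_transpose_mul_add_mul_le {A P : Matrix n n ℝ} (hP : P.PosSemidef) :
    (Aᵀ * P + P * A).trace ≤ 2 * ‖(traceCLM : Matrix n n ℝ →L[ℝ] ℝ)‖ * ‖A‖ * P.trace := by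
  have hsymm : (Aᵀ * P).trace = (P * A).trace := by
    rw [← Matrix.trace_transpose, Matrix.transpose_mul, Matrix.transpose_transpose,
      transpose_eq_of_posSemidef hP]
  calc (Aᵀ * P + P * A).trace = 2 * traceCLM (P * A) := by
        rw [Matrix.trace_add, hsymm, traceCLM_apply, two_mul]
    _ ≤ 2 * (‖(traceCLM : Matrix n n ℝ →L[ℝ] ℝ)‖ * (P.trace * ‖A‖)) := by
        gcongr
        refine (Real.le_norm_self _).trans (traceCLM.le_opNorm_of_le ?_)
        exact (Matrix.frobenius_norm_mul _ _).trans
          (mul_le_mul_of_nonneg_right (norm_le_trace hP) (norm_nonneg _))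
    _ = _ := by ring

end Trace

/-! ### Lipschitz dependence of the cost-to-go on the feedback -/

namespace Coeffs

variable {n m : ℕ} {c : Coeffs n m} {T s t R β ν σ : ℝ}
  {P P' : ℝ → Matrix (Fin n) (Fin n) ℝ}

lemma norm_Upsilon_le (hν : ‖(c.M s s)⁻¹‖ ≤ ν) (hβ : ‖c.B s‖ ≤ β) (hσ : ‖c.S s s‖ ≤ σ)
    (hR : ‖P s‖ ≤ R) : ‖c.Upsilon P s‖ ≤ ν * (β * R + σ) := by
  have hν0 : 0 ≤ ν := (norm_nonneg _).trans hν
  have hβ0 : 0 ≤ β := (norm_nonneg _).trans hβ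
  calc ‖c.Upsilon P s‖ ≤ ‖(c.M s s)⁻¹‖ * ‖(c.B s)ᵀ * P s + c.S s s‖ :=
        Matrix.frobenius_norm_mul _ _
    _ ≤ ‖(c.M s s)⁻¹‖ * (‖(c.B s)ᵀ‖ * ‖P s‖ + ‖c.S s s‖) := by
        gcongr
        exact norm_add_le_of_le (Matrix.frobenius_norm_mul _ _) le_rfl
    _ ≤ ν * (β * R + σ) := by
        rw [Matrix.frobenius_norm_transpose]
        gcongr

lemma norm_Upsilon_sub_le (hν : ‖(c.M s s)⁻¹‖ ≤ ν) (hβ : ‖c.B s‖ ≤ β) :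
    ‖c.Upsilon P s - c.Upsilon P' s‖ ≤ ν * β * ‖P s - P' s‖ := by
  have hν0 : 0 ≤ ν := (norm_nonneg _).trans hν
  calc ‖c.Upsilon P s - c.Upsilon P' s‖ = ‖(c.M s s)⁻¹ * ((c.B s)ᵀ * (P s - P' s))‖ := by
        rw [Upsilon, Upsilon, ← Matrix.mul_sub, add_sub_add_right_eq_sub, ← Matrix.mul_sub]
    _ ≤ ‖(c.M s s)⁻¹‖ * (‖(c.B s)ᵀ‖ * ‖P s - P' s‖) :=
        (Matrix.frobenius_norm_mul _ _).trans
          (mul_le_mul_of_nonneg_left (Matrix.frobenius_norm_mul _ _) (norm_nonneg _))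
    _ ≤ ν * (β * ‖P s - P' s‖) := by
        rw [Matrix.frobenius_norm_transpose]
        gcongr
    _ = ν * β * ‖P s - P' s‖ := (mul_assoc _ _ _).symm

lemma norm_closedLoop_sub_le (hν : ‖(c.M s s)⁻¹‖ ≤ ν) (hβ : ‖c.B s‖ ≤ β) :
    ‖c.closedLoop P s - c.closedLoop P' s‖ ≤ β * (ν * β * ‖P s - P' s‖) := by
  have hβ0 : 0 ≤ β := (norm_nonneg _).trans hβ
  rw [closedLoop, closedLoop, sub_sub_sub_cancel_left, ← Matrix.mul_sub, norm_sub_rev (P s)]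
  exact (Matrix.frobenius_norm_mul _ _).trans
    (mul_le_mul hβ (norm_Upsilon_sub_le hν hβ) (norm_nonneg _) hβ0)

lemma exists_ae_norm_le (h1 : H1 T c) (h2 : H2 T c) (h4 : H4 T c) :
    ∃ ν β σ : ℝ, 0 ≤ ν ∧ 0 ≤ β ∧ 0 ≤ σ ∧ ∀ᵐ s ∂volume.restrict (Icc 0 T),
      ‖(c.M s s)⁻¹‖ ≤ ν ∧ ‖c.B s‖ ≤ β ∧ ‖c.S s s‖ ≤ σ := by
  obtain ⟨ν, hν0, hν⟩ := exists_ae_norm_le_of_memLp_top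
    (memLp_top_of_continuousOn (ν := volume) isCompact_Icc (continuousOn_inv h2))
  obtain ⟨β, hβ0, hβ⟩ := exists_ae_norm_le_of_memLp_top (memLp_B h1)
  obtain ⟨σ, hσ0, hσ⟩ := exists_ae_norm_le_of_memLp_top
    (memLp_top_of_continuousOn (ν := volume) isCompact_Icc (continuousOn_diag h4.S_C1.continuousOn))
  exact ⟨ν, β, σ, hν0, hβ0, hσ0, hν.and (hβ.and hσ)⟩

lemma exists_isAdmissible (hT : 0 ≤ T) (h1 : H1 T c) (h2 : H2 T c) (h4 : H4 T c) (hR : 0 ≤ R) :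
    ∃ L v, 0 ≤ v ∧ ∀ P : ℝ → Matrix (Fin n) (Fin n) ℝ, ContinuousOn P (Icc 0 T) →
      (∀ t ∈ Icc 0 T, ‖P t‖ ≤ R) →
      IsAdmissible T L v (c.closedLoop P) (output (c.Upsilon P)) := by
  obtain ⟨ν, β, σ, hν0, hβ0, hσ0, hbound⟩ := exists_ae_norm_le h1 h2 h4
  set u := ν * (β * R + σ)
  refine ⟨∫ s in 0..T, (‖c.A s‖ + β * u), ‖(1 : Matrix (Fin n) (Fin n) ℝ)‖ + u, by positivity,
    fun P hP hPR => ?_⟩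
  have hU : ∀ᵐ s ∂volume.restrict (Icc 0 T), ‖c.Upsilon P s‖ ≤ u := by
    filter_upwards [hbound, ae_restrict_mem measurableSet_Icc] with s ⟨hν, hβ, hσ⟩ hs
    exact norm_Upsilon_le hν hβ hσ (hPR s hs)
  have hclosed := integrableOn_closedLoop h1 h2 h4 hP
  refine ⟨hclosed, integral_tail_mono_ae hclosed.norm
    ((integrableOn_A h1).norm.add (integrableOn_const (by simp))) (left_mem_Icc.2 hT) ?_,
    memLp_output (memLp_Upsilon h1 h2 h4 hP), ?_⟩
  · filter_upwards [hbound, hU] with s ⟨_, hβ, _⟩ hs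
    exact norm_sub_le_of_le le_rfl ((Matrix.frobenius_norm_mul _ _).trans
      (mul_le_mul hβ hs (norm_nonneg _) hβ0))
  · filter_upwards [hU] with s hs
    exact (norm_output_le _ s).trans (by gcongr)

lemma exists_value_lipschitz (hT : 0 < T) (h1 : H1 T c) (h2 : H2 T c) (h3 : H3 T c) (h4 : H4 T c)
    (hR : 0 ≤ R) :
    ∃ C, 0 ≤ C ∧ ∀ P P' : ℝ → Matrix (Fin n) (Fin n) ℝ, ContinuousOn P (Icc 0 T) →
      ContinuousOn P' (Icc 0 T) → (∀ t ∈ Icc 0 T, ‖P t‖ ≤ R) → (∀ t ∈ Icc 0 T, ‖P' t‖ ≤ R) →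
      ∀ t ∈ Icc 0 T, ‖c.value T P t - c.value T P' t‖ ≤ ∫ s in t..T, C * ‖P s - P' s‖ := by
  obtain ⟨ν, β, σ, hν0, hβ0, -, hbound⟩ := exists_ae_norm_le h1 h2 h4
  obtain ⟨L, v, hv, hadm⟩ := exists_isAdmissible hT.le h1 h2 h4 hR
  obtain ⟨C, hC, hcost⟩ := exists_cost_lipschitz hT.le (h3.G_C1.isPrimitive hT).continuousOn
    (isC1Kernel_kernel hT h2 h3 h4).continuousOn L hv
  refine ⟨C * ((β + 1) * (ν * β)), by positivity, fun P P' hP hP' hPR hPR' t ht => ?_⟩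
  have h := hadm P hP hPR
  have h' := hadm P' hP' hPR'
  refine (hcost _ _ _ _ h h' t ht).trans ?_
  rw [← intervalIntegral.integral_const_mul]
  refine integral_tail_mono_ae ((h.integrableOn_norm_sub_add h').const_mul C)
    (((hP.sub hP').norm.integrableOn_compact isCompact_Icc).const_mul _) ht ?_
  filter_upwards [ae_restrict_of_ae_restrict_of_subset (Icc_subset_Icc_left ht.1) hbound]
    with s ⟨hν, hβ, _⟩
  rw [norm_output_sub, mul_assoc C]
  gcongr
  exact (add_le_add (norm_closedLoop_sub_le hν hβ) (norm_Upsilon_sub_le hν hβ)).trans_eq (by ring)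

/-! ### A priori bound -/

lemma trace_closedLoop_add_source_le (h2 : H2 T c) (h5 : H5 T c) {ρ : ℝ → ℝ} (hs : s ∈ Icc 0 T)
    (hP : (P s).PosSemidef) (hρ : ρ s ∈ Icc 0 1) :
    ((c.closedLoop (fun r => ρ r • P r) s)ᵀ * P s + P s * c.closedLoop (fun r => ρ r • P r) s
        + c.source T (fun r => ρ r • P r) s).trace
      ≤ (c.Q s s).trace
        + 2 * ‖(traceCLM : Matrix (Fin n) (Fin n) ℝ →L[ℝ] ℝ)‖ * ‖c.closedLoop 0 s‖
          * (P s).trace := by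
  have hM := h2.M_pos s hs s hs
  have hN := hM.inv.posSemidef
  have hzero : c.closedLoop 0 s = c.A s - c.B s * ((c.M s s)⁻¹ * c.S s s) := by
    rw [closedLoop, Upsilon, Pi.zero_apply, Matrix.mul_zero, zero_add]
  have hquad : 0 ≤ ρ s * (2 - ρ s) * (((c.B s)ᵀ * P s)ᵀ * (c.M s s)⁻¹ * ((c.B s)ᵀ * P s)).trace :=
    mul_nonneg (mul_nonneg hρ.1 (by linarith [hρ.2]))
      (posSemidef_transpose_mul_mul hN _).trace_nonneg
  have hSNS := (posSemidef_transpose_mul_mul hN (c.S s s)).trace_nonneg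
  have hdrift := (posSemidef_drift h5 (fun r => ρ r • P r) hs).trace_nonneg
  have hlin := trace_transpose_mul_add_mul_le (A := c.closedLoop 0 s) hP
  rw [source, kernel, transpose_output_mul_fromBlocks_mul_output, add_sub, closedLoop,
    scaled_riccati_completion (U := c.Upsilon (fun r => ρ r • P r) s)
      (transpose_eq_of_posSemidef hP) (transpose_eq_of_posSemidef hN)
      (Matrix.mul_nonsing_inv _ hM.det_pos.ne'.isUnit) rfl, ← hzero]
  simp only [Matrix.trace_sub, Matrix.trace_add, Matrix.trace_smul, smul_eq_mul] at hlin ⊢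
  linarith

lemma trace_le_add_integral (hT : 0 < T) (h1 : H1 T c) (h2 : H2 T c) (h3 : H3 T c) (h4 : H4 T c)
    (h5 : H5 T c) {ρ : ℝ → ℝ} (hρP : ContinuousOn (fun s => ρ s • P s) (Icc 0 T))
    (hρ : ∀ s, ρ s ∈ Icc 0 1) (hfix : ∀ t ∈ Icc 0 T, P t = c.value T (fun s => ρ s • P s) t)
    (ht : t ∈ Icc 0 T) :
    (P t).trace ≤ ((c.G T).trace + ∫ s in 0..T, |(c.Q s s).trace|)
      + ∫ s in t..T, 2 * ‖(traceCLM : Matrix (Fin n) (Fin n) ℝ →L[ℝ] ℝ)‖ * ‖c.closedLoop 0 s‖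
          * (P s).trace := by
  set k := fun s => 2 * ‖(traceCLM : Matrix (Fin n) (Fin n) ℝ →L[ℝ] ℝ)‖ * ‖c.closedLoop 0 s‖
  have hPpos : ∀ s ∈ Icc 0 T, (P s).PosSemidef := fun s hs =>
    hfix s hs ▸ posSemidef_value h2 h3 h5 _ hs
  set f := fun s => (c.closedLoop (fun r => ρ r • P r) s)ᵀ * P s
    + P s * c.closedLoop (fun r => ρ r • P r) s + c.source T (fun r => ρ r • P r) s
  have hP : IsPrimitive 0 T P fun s => -f s :=
    (isPrimitive_value hT h1 h2 h3 h4 hρP).congr (fun s hs => (hfix s hs).symm) fun s hs => by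
      simp only [f, ← hfix s hs]
  have htr : IsPrimitive 0 T (fun s => (P s).trace) fun s => -(f s).trace := by
    simpa only [traceCLM_apply, Matrix.trace_neg] using hP.clm_comp traceCLM
  have hQ : IntegrableOn (fun s => |(c.Q s s).trace|) (Icc 0 T) :=
    ((traceCLM.continuous.comp_continuousOn
      (continuousOn_diag h3.Q_C1.continuousOn)).norm).integrableOn_compact isCompact_Icc
  have hk : IntegrableOn (fun s => k s * (P s).trace) (Icc 0 T) :=
    IntegrableOn.mul_continuousOn
      ((integrableOn_closedLoop h1 h2 h4 continuousOn_const).norm.const_mul _)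
      htr.continuousOn isCompact_Icc
  have hPT : P T = c.G T := (hfix T (right_mem_Icc.2 hT.le)).trans
    (cost_right hT.le (integrableOn_closedLoop h1 h2 h4 hρP))
  calc (P t).trace = (c.G T).trace + ∫ s in t..T, (f s).trace := by
        rw [← hPT, ← sub_neg_eq_add, ← intervalIntegral.integral_neg]
        exact htr.eq_sub_tail ht
    _ ≤ (c.G T).trace + ∫ s in t..T, (|(c.Q s s).trace| + k s * (P s).trace) := by
        refine add_le_add le_rfl (integral_tail_mono_ae (integrable_neg_iff.1 htr.integrable)
          (hQ.add hk) ht ?_)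
        filter_upwards [ae_restrict_mem measurableSet_Icc] with s hs
        have hs' : s ∈ Icc 0 T := ⟨ht.1.trans hs.1, hs.2⟩
        exact (trace_closedLoop_add_source_le h2 h5 hs' (hPpos s hs') (hρ s)).trans
          (add_le_add (le_abs_self _) le_rfl)
    _ ≤ _ := by
        rw [intervalIntegral.integral_add (intervalIntegrable_tail hQ ht)
          (intervalIntegrable_tail hk ht), ← add_assoc]
        gcongr
        exact antitoneOn_integral_tail hQ (fun _ => abs_nonneg _) (left_mem_Icc.2 hT.le) ht ht.1

lemma exists_apriori_bound (hT : 0 < T) (h1 : H1 T c) (h2 : H2 T c) (h3 : H3 T c) (h4 : H4 T c)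
    (h5 : H5 T c) :
    ∃ R > 0, ∀ (P : ℝ → Matrix (Fin n) (Fin n) ℝ) (ρ : ℝ → ℝ),
      ContinuousOn P (Icc 0 T) → ContinuousOn (fun s => ρ s • P s) (Icc 0 T) →
      (∀ s, ρ s ∈ Icc 0 1) → (∀ t ∈ Icc 0 T, P t = c.value T (fun s => ρ s • P s) t) →
      ∀ t ∈ Icc 0 T, ‖P t‖ ≤ R := by
  set c₀ := (c.G T).trace + ∫ s in 0..T, |(c.Q s s).trace|
  set k := fun s => 2 * ‖(traceCLM : Matrix (Fin n) (Fin n) ℝ →L[ℝ] ℝ)‖ * ‖c.closedLoop 0 s‖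
  have hk : IntegrableOn k (Icc 0 T) :=
    (integrableOn_closedLoop h1 h2 h4 continuousOn_const).norm.const_mul _
  have hk0 : ∀ s, 0 ≤ k s := fun s => by positivity
  have hc₀ : 0 ≤ c₀ := add_nonneg (h3.G_nonneg T (right_mem_Icc.2 hT.le)).trace_nonneg
    (intervalIntegral.integral_nonneg_of_forall hT.le fun _ => abs_nonneg _)
  refine ⟨c₀ * Real.exp (∫ s in 0..T, k s) + 1, by positivity,
    fun P ρ hP hρP hρ hfix t ht => ?_⟩
  calc ‖P t‖ ≤ (P t).trace := norm_le_trace (hfix t ht ▸ posSemidef_value h2 h3 h5 _ ht)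
    _ ≤ c₀ * Real.exp (∫ s in t..T, k s) :=
        le_mul_exp_of_le_add_integral hk hk0 (traceCLM.continuous.comp_continuousOn hP) hc₀
          (fun s hs => trace_le_add_integral hT h1 h2 h3 h4 h5 hρP hρ hfix hs) ht
    _ ≤ c₀ * Real.exp (∫ s in 0..T, k s) := by
        gcongr
        exact antitoneOn_integral_tail hk hk0 (left_mem_Icc.2 hT.le) ht ht.1
    _ ≤ c₀ * Real.exp (∫ s in 0..T, k s) + 1 := le_add_of_nonneg_right zero_le_one

end Coeffs

/-! ### Radial truncation -/

section Truncation

variable {E : Type*} [NormedAddCommGroup E] [NormedSpace ℝ E] {R : ℝ}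

/-- The radial retraction onto the ball of radius `R`. -/
def truncate (R : ℝ) (x : E) : E := (R / max R ‖x‖) • x

lemma div_max_mem_Icc (hR : 0 < R) (r : ℝ) : R / max R r ∈ Icc (0 : ℝ) 1 :=
  ⟨div_nonneg hR.le (le_max_of_le_left hR.le),
    (div_le_one (lt_max_of_lt_left hR)).2 (le_max_left _ _)⟩

lemma norm_truncate_le (hR : 0 < R) (x : E) : ‖truncate R x‖ ≤ R := by
  rw [truncate, norm_smul, Real.norm_of_nonneg (div_max_mem_Icc hR _).1, div_mul_eq_mul_div,
    div_le_iff₀ (lt_max_of_lt_left hR)]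
  exact mul_le_mul_of_nonneg_left (le_max_right _ _) hR.le

lemma truncate_of_norm_le (hR : 0 < R) {x : E} (hx : ‖x‖ ≤ R) : truncate R x = x := by
  rw [truncate, max_eq_left hx, div_self hR.ne', one_smul]

lemma abs_div_max_sub_div_max_mul_le (hR : 0 < R) {r r' : ℝ} (hr'0 : 0 ≤ r') :
    |R / max R r - R / max R r'| * r' ≤ |r - r'| := by
  have : 0 < max R r := lt_max_of_lt_left hR
  have hr' : 0 < max R r' := lt_max_of_lt_left hR
  have hmax : |max R r' - max R r| ≤ |r - r'| := by
    rw [max_comm R, max_comm R, abs_sub_comm r]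
    exact abs_max_sub_max_le_abs r' r R
  have hsub : R / max R r - R / max R r' = R / max R r * ((max R r' - max R r) / max R r') := by
    field_simp
  calc |R / max R r - R / max R r'| * r'
      = R / max R r * |max R r' - max R r| * (r' / max R r') := by
        rw [hsub, abs_mul, abs_of_nonneg (div_max_mem_Icc hR r).1, abs_div, abs_of_pos hr']
        ring
    _ ≤ 1 * |r - r'| * 1 := by
        gcongr ?_ * ?_ * ?_
        · exact (div_max_mem_Icc hR r).2
        · exact (div_le_one hr').2 (le_max_right _ _)
    _ = |r - r'| := by rw [one_mul, mul_one]

lemma norm_truncate_sub_le (hR : 0 < R) (x y : E) :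
    ‖truncate R x - truncate R y‖ ≤ 2 * ‖x - y‖ := by
  have hρ := div_max_mem_Icc hR ‖x‖
  calc ‖truncate R x - truncate R y‖
      = ‖(R / max R ‖x‖) • (x - y) + (R / max R ‖x‖ - R / max R ‖y‖) • y‖ := by
        rw [truncate, truncate, smul_sub, sub_smul, sub_add_sub_cancel]
    _ ≤ R / max R ‖x‖ * ‖x - y‖ + |R / max R ‖x‖ - R / max R ‖y‖| * ‖y‖ := by
        refine (norm_add_le _ _).trans_eq ?_
        rw [norm_smul, norm_smul, Real.norm_of_nonneg hρ.1, Real.norm_eq_abs]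
    _ ≤ ‖x - y‖ + ‖x - y‖ :=
        add_le_add (mul_le_of_le_one_left (norm_nonneg _) hρ.2)
          ((abs_div_max_sub_div_max_mul_le hR (norm_nonneg _)).trans (abs_norm_sub_norm_le x y))
    _ = 2 * ‖x - y‖ := (two_mul _).symm

lemma continuous_truncate (hR : 0 < R) : Continuous (truncate R : E → E) :=
  (LipschitzWith.of_dist_le_mul (K := 2) fun x y => by
    simpa only [dist_eq_norm, NNReal.coe_ofNat] using norm_truncate_sub_le hR x y).continuous

end Truncation

/-! ### Existence and uniqueness -/

namespace Coeffs

variable {n m : ℕ} {c : Coeffs n m} {T R : ℝ} {P P' : ℝ → Matrix (Fin n) (Fin n) ℝ}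

lemma exists_eq_value_truncate (hT : 0 < T) (h1 : H1 T c) (h2 : H2 T c) (h3 : H3 T c)
    (h4 : H4 T c) (hR : 0 < R) :
    ∃ P : ℝ → Matrix (Fin n) (Fin n) ℝ, ContinuousOn P (Icc 0 T) ∧
      ∀ t ∈ Icc 0 T, P t = c.value T (fun s => truncate R (P s)) t := by
  obtain ⟨C, hC, hlip⟩ := exists_value_lipschitz hT h1 h2 h3 h4 hR.le
  have htrunc : ∀ {u : ℝ → Matrix (Fin n) (Fin n) ℝ}, ContinuousOn u (Icc 0 T) →
      ContinuousOn (fun s => truncate R (u s)) (Icc 0 T) := fun hu =>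
    (continuous_truncate hR).comp_continuousOn hu
  refine exists_fixedPoint_of_norm_sub_le_integral (k := fun _ => C * 2) hT.le
    (integrableOn_const (by simp)) (fun _ => by positivity)
    (fun u => c.value T fun s => truncate R (u s))
    (fun u hu => (isPrimitive_value hT h1 h2 h3 h4 (htrunc hu)).continuousOn)
    fun u v hu hv t ht => ?_
  refine (hlip _ _ (htrunc hu) (htrunc hv) (fun s _ => norm_truncate_le hR _)
    (fun s _ => norm_truncate_le hR _) t ht).trans (integral_tail_mono_ae
      ((((htrunc hu).sub (htrunc hv)).norm.integrableOn_compact isCompact_Icc).const_mul C)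
      (((hu.sub hv).norm.integrableOn_compact isCompact_Icc).const_mul (C * 2)) ht
      (ae_of_all _ fun s => ?_))
  rw [mul_assoc]
  exact mul_le_mul_of_nonneg_left (norm_truncate_sub_le hR _ _) hC

lemma exists_eq_value (hT : 0 < T) (h1 : H1 T c) (h2 : H2 T c) (h3 : H3 T c) (h4 : H4 T c)
    (h5 : H5 T c) :
    ∃ P : ℝ → Matrix (Fin n) (Fin n) ℝ, ContinuousOn P (Icc 0 T) ∧
      ∀ t ∈ Icc 0 T, P t = c.value T P t := by
  obtain ⟨R, hR, hbound⟩ := exists_apriori_bound hT h1 h2 h3 h4 h5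
  obtain ⟨P, hP, hfix⟩ := exists_eq_value_truncate hT h1 h2 h3 h4 hR
  have htrunc : ContinuousOn (fun s => truncate R (P s)) (Icc 0 T) :=
    (continuous_truncate hR).comp_continuousOn hP
  have hle := hbound P _ hP htrunc (fun s => div_max_mem_Icc hR ‖P s‖) hfix
  exact ⟨_, htrunc, fun t ht => (truncate_of_norm_le hR (hle t ht)).trans (hfix t ht)⟩

lemma eqOn_of_eq_value (hT : 0 < T) (h1 : H1 T c) (h2 : H2 T c) (h3 : H3 T c) (h4 : H4 T c)
    (hP : ContinuousOn P (Icc 0 T)) (hP' : ContinuousOn P' (Icc 0 T))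
    (hfix : ∀ t ∈ Icc 0 T, P t = c.value T P t) (hfix' : ∀ t ∈ Icc 0 T, P' t = c.value T P' t) :
    EqOn P P' (Icc 0 T) := by
  obtain ⟨R, hR⟩ := isCompact_Icc.exists_bound_of_continuousOn (hP.prodMk hP')
  obtain ⟨C, hC, hlip⟩ := exists_value_lipschitz hT h1 h2 h3 h4
    ((norm_nonneg _).trans (hR 0 (left_mem_Icc.2 hT.le)))
  have hvolterra : ∀ t ∈ Icc 0 T, ‖P t - P' t‖ ≤ 0 + ∫ s in t..T, C * ‖P s - P' s‖ :=
    fun t ht => by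
      rw [zero_add, hfix t ht, hfix' t ht]
      exact hlip P P' hP hP' (fun s hs => (norm_fst_le _).trans (hR s hs))
        (fun s hs => (norm_snd_le _).trans (hR s hs)) t ht
  intro t ht
  have hgronwall := le_mul_exp_of_le_add_integral (k := fun _ => C) (integrableOn_const (by simp))
    (fun _ => hC) (hP.sub hP').norm le_rfl hvolterra ht
  rw [zero_mul] at hgronwall
  exact sub_eq_zero.1 (norm_le_zero_iff.1 hgronwall)

end Coeffs

end EqRiccati

open EqRiccati EqRiccati.Coeffs in
theorem mainTheorem2 {n m : ℕ} (T : ℝ) (hT : 0 < T) (c : EqRiccati.Coeffs n m)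
    (h1 : EqRiccati.H1 T c) (h2 : EqRiccati.H2 T c) (h3 : EqRiccati.H3 T c)
    (h4 : EqRiccati.H4 T c) (h5 : EqRiccati.H5 T c) :
    ∃ P : ℝ → Matrix (Fin n) (Fin n) ℝ,
      EqRiccati.IsRiccatiSolution T c P ∧
      (∀ P' : ℝ → Matrix (Fin n) (Fin n) ℝ, EqRiccati.IsRiccatiSolution T c P' →
        Set.EqOn P' P (Set.Icc 0 T)) ∧
      ∀ t ∈ Set.Icc 0 T, (P t).PosSemidef := by
  obtain ⟨P, hP, hvalue⟩ := exists_eq_value hT h1 h2 h3 h4 h5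
  refine ⟨P, (isRiccatiSolution_iff hT h1 h2 h3 h4 h5).2 ⟨hP, hvalue⟩, fun P' hP' => ?_,
    fun t ht => ?_⟩
  · obtain ⟨hP'cont, hvalue'⟩ := (isRiccatiSolution_iff hT h1 h2 h3 h4 h5).1 hP'
    exact eqOn_of_eq_value hT h1 h2 h3 h4 hP'cont hP hvalue' hvalue
  · rw [hvalue t ht]
    exact posSemidef_value h2 h3 h5 P ht

end
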